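/- Let $G\supset T$ be a simple, simply connected complex algebraic group with a maximal torus, let $T^*$ be the character lattice of $T$ (the weight lattice), $\Phi\subset T^*$ the roots, $\alpha_1,\dots,\alpha_n$ simple roots, $\theta$ the highest root, $Q^\vee$ the coroot lattice, $W$ the Weyl group and $W_a=Q^\vee\rtimes W$ the affine Weyl group, with translations $t_\lambda$ ($\lambda\in Q^\vee$) and $s_0=t_{\theta^\vee}s_\theta$. Let $R$ be a domain of characteristic $0$ and $F$ a commutative one-dimensional formal group law over $R$. Let $S$ be the formal group algebra of $T^*$: the power series ring over $R$ in $x_{\omega_1},\dots,x_{\omega_n}$ for a basis $(\omega_i)$ of $T^*$, with the elements $x_\lambda$ ($\lambda\in T^*$) determined by $x_{\lambda+\mu}=F(x_\lambda,x_\mu)$; if $F=x+y-cxy$ with $c\in R$, one may also take for $S$ the polynomial version $R[x_\lambda:\lambda\in T^*]/(x_0,\;x_{\lambda+\mu}-x_\lambda-x_\mu+c\,x_\lambda x_\mu)$. The group $W$ acts on $S$ by $w(x_\lambda)=x_{w\lambda}$. Assume that $x_\alpha$ and $x_\beta$ are coprime, in the sense that $x_\alpha\mid x_\beta s$ implies $x_\alpha\mid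 s$ for $s\in S$, for all roots $\alpha\ne\pm\beta$ that both lie in $2T^*$ (such pairs exist only in type $C_n$ with $n\ge2$, and the condition then holds, for example, if $2\in R^\times$). Let $\mathcal Q=S[x_\alpha^{-1}:\alpha\in\Phi]$, let $W_a$ act on $\mathcal Q$ through $W_a\to W$, and let $\mathcal Q_{W_a}$ be the twisted group algebra: the free left $\mathcal Q$-module with basis $\eta_w$ ($w\in W_a$) and product $c\eta_w\,c'\eta_{w'}=c\,w(c')\,\eta_{ww'}$. Let $\mathbf D_{W_a}\subset\mathcal Q_{W_a}$ be the subalgebra generated by $S$, by $X_i=\frac1{x_{\alpha_i}}(1-\eta_{s_i})$ for $1\le i\le n$, and by $X_0=\frac1{x_{-\theta}}(1-\eta_{s_0})$. Put $\mathcal Q_{W_a}^*=\mathrm{Hom}_{\mathcal Q}(\mathcal Q_{W_a},\mathcal Q)$ and $\mathbf D_{W_a}^*=\mathrm{Hom}_S(\mathbf D_{W_a},S)$ (left modules), and let $W$ act on $\mathcal Q_{W_a}^*$ by $(v\bullet f)(z)=f(z\eta_v)$. Every element of $\mathbf D_{W_a}^*$ extends uniquely to an element of $\mathcal Q_{W_a}^*$,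 so that $\mathbf D_{W_a}^*\subset\mathcal Q_{W_a}^*$, and: (1) $\mathbf D_{W_a}^*$ is the set of all $f\in\mathcal Q_{W_a}^*$ such that $f(\eta_w)\in S$ for all $w\in W_a$ and $$f\big((1-\eta_{t_{\alpha^\vee}})^d\eta_w\big)\in x_\alpha^dS\quad\text{and}\quad f\big((1-\eta_{t_{\alpha^\vee}})^{d-1}(1-\eta_{s_\alpha})\eta_w\big)\in x_\alpha^dS\qquad\text{for all }\alpha\in\Phi,\ w\in W_a,\ d\ge1.$$ (2) $(\mathbf D_{W_a}^*)^W$ is the set of all $f\in(\mathcal Q_{W_a}^*)^W$ such that $f(\eta_w)\in S$ for all $w\in W_a$ and $$f\big((1-\eta_{t_{\alpha^\vee}})^d\eta_w\big)\in x_\alpha^dS\qquad\text{for all }\alpha\in\Phi,\ w\in W_a,\ d\ge1.$$ -/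

import Mathlib

universe u v

noncomputable section

namespace AffineDemazure

open MvPowerSeries

variable {R : Type u} [CommRing R]

/-- A formal group law has a formal inverse `g`, i.e. `F (X, g (X)) = 0`. -/
lemma exists_formal_neg (F : FormalGroup R) :
    ∃ g : PowerSeries R, g.constantCoeff = 0 ∧
      F.toPowerSeries.subst ![(PowerSeries.X : PowerSeries R), g] = (0 : PowerSeries R) := by
  have hs : ∀ g : PowerSeries R, g.constantCoeff = 0 →
      HasSubst ![(PowerSeries.X : PowerSeries R), g] := fun g hg =>
    hasSubst_of_constantCoeff_zero (by
      intro s; fin_cases s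
      · exact PowerSeries.constantCoeff_X
      · exact hg)
  have key : ∀ (n : ℕ) (g h : PowerSeries R), g.constantCoeff = 0 → h.constantCoeff = 0 →
      (PowerSeries.X ^ n ∣ g - h) →
      PowerSeries.X ^ (n + 1) ∣ (g - F.toPowerSeries.subst ![(PowerSeries.X : PowerSeries R), g])
        - (h - F.toPowerSeries.subst ![(PowerSeries.X : PowerSeries R), h]) := by
    intro n g h hg hh hd
    have hXg : (PowerSeries.X : PowerSeries R) ∣ g := PowerSeries.X_dvd_iff.2 hg
    have hXh : (PowerSeries.X : PowerSeries R) ∣ h := PowerSeries.X_dvd_iff.2 hh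
    rw [PowerSeries.X_pow_dvd_iff]
    intro m hm
    have e1 : ∀ q : PowerSeries R, q.constantCoeff = 0 →
        (PowerSeries.coeff m) (F.toPowerSeries.subst ![(PowerSeries.X : PowerSeries R), q])
        = ∑ᶠ d : Fin 2 →₀ ℕ, coeff d F.toPowerSeries •
          PowerSeries.coeff m ((PowerSeries.X : PowerSeries R) ^ d 0 * q ^ d 1) := by
      intro q hq
      rw [PowerSeries.coeff, coeff_subst (hs q hq)]
      congr! 3 with d
      rw [Finsupp.prod_fintype _ _ (by simp)]
      simp
    have f1 : ∀ q : PowerSeries R, q.constantCoeff = 0 →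
        (Function.support fun d : Fin 2 →₀ ℕ => coeff d F.toPowerSeries •
          PowerSeries.coeff m ((PowerSeries.X : PowerSeries R) ^ d 0 * q ^ d 1)).Finite := by
      intro q hq
      have := coeff_subst_finite (hs q hq) F.toPowerSeries (Finsupp.single () m)
      have e : (fun d : Fin 2 →₀ ℕ => coeff d F.toPowerSeries •
          PowerSeries.coeff m ((PowerSeries.X : PowerSeries R) ^ d 0 * q ^ d 1)) =
          fun d => coeff d F.toPowerSeries • coeff (Finsupp.single () m)
            (d.prod fun s e => ![(PowerSeries.X : PowerSeries R), q] s ^ e) := by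
        funext d
        rw [Finsupp.prod_fintype _ _ (by simp), PowerSeries.coeff]
        simp
      rw [e]
      exact this
    rw [map_sub, map_sub, map_sub, e1 g hg, e1 h hh, sub_sub_sub_comm,
      ← finsum_sub_distrib (f1 g hg) (f1 h hh),
      finsum_eq_single _ (Finsupp.single 1 1)]
    · simp [F.lin_coeff_Y]
    · intro d hd1
      rw [← smul_sub, ← map_sub, ← mul_sub]
      have : PowerSeries.X ^ (n + 1) ∣
          (PowerSeries.X : PowerSeries R) ^ d 0 * (g ^ d 1 - h ^ d 1) := by
        rcases Nat.eq_zero_or_pos (d 1) with h1 | h1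
        · simp [h1]
        rcases Nat.eq_zero_or_pos (d 0) with h0 | h0
        · have h2 : 2 ≤ d 1 := by
            by_contra hc
            apply hd1
            ext s
            fin_cases s
            · simpa using h0
            · simp; omega
          rw [h0, pow_zero, one_mul, ← geom_sum₂_mul, pow_succ']
          refine mul_dvd_mul (Finset.dvd_sum fun i hi => ?_) hd
          have hi' := Finset.mem_range.1 hi
          rcases Nat.eq_zero_or_pos i with rfl | hi0
          · exact Dvd.dvd.mul_left (hXh.trans (dvd_pow_self _ (by omega))) _
          · exact Dvd.dvd.mul_right (hXg.trans (dvd_pow_self _ hi0.ne')) _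
        · rw [pow_succ']
          exact mul_dvd_mul (dvd_pow_self _ h0.ne') (hd.trans (sub_dvd_pow_sub_pow g h _))
      rw [PowerSeries.X_pow_dvd_iff.1 this m hm, smul_zero]
  let Φ : PowerSeries R → PowerSeries R := fun g =>
    g - F.toPowerSeries.subst ![(PowerSeries.X : PowerSeries R), g]
  have hΦ0 : ∀ g : PowerSeries R, g.constantCoeff = 0 → (Φ g).constantCoeff = 0 := by
    intro g hg
    have : (F.toPowerSeries.subst ![(PowerSeries.X : PowerSeries R), g] :
        PowerSeries R).constantCoeff = 0 :=
      constantCoeff_subst_eq_zero (hs g hg) (by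
        intro s; fin_cases s
        · exact PowerSeries.constantCoeff_X
        · exact hg) F.zero_constantCoeff
    change PowerSeries.constantCoeff (g - _) = 0
    rw [map_sub, hg, zero_sub, neg_eq_zero]
    exact this
  let a : ℕ → PowerSeries R := fun n => Φ^[n] 0
  have a_succ : ∀ n, a (n + 1) = Φ (a n) := fun n => Function.iterate_succ_apply' Φ n 0
  have a0 : ∀ n, (a n).constantCoeff = 0 := by
    intro n
    induction n with
    | zero => simp [a]
    | succ n ih => rw [a_succ]; exact hΦ0 _ ih
  have step : ∀ n, PowerSeries.X ^ n ∣ a (n + 1) - a n := by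
    intro n
    induction n with
    | zero => simp
    | succ n ih =>
      rw [a_succ (n + 1), a_succ n]
      exact key n _ _ (hΦ0 _ (a0 n)) (a0 n) (by rw [← a_succ]; exact ih)
  have stable : ∀ n k, PowerSeries.X ^ n ∣ a (n + k) - a n := by
    intro n k
    induction k with
    | zero => simp
    | succ k ih =>
      have h1 := (pow_dvd_pow PowerSeries.X (Nat.le_add_right n k)).trans (step (n + k))
      have := dvd_add h1 ih
      rwa [sub_add_sub_cancel] at this
  let g : PowerSeries R := PowerSeries.mk fun n => PowerSeries.coeff n (a (n + 1))
  have hga : ∀ n, PowerSeries.X ^ n ∣ g - a n := by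
    intro n
    rw [PowerSeries.X_pow_dvd_iff]
    intro m hm
    obtain ⟨k, rfl⟩ := Nat.exists_eq_add_of_lt hm
    have := PowerSeries.X_pow_dvd_iff.1 (stable (m + 1) k) m (by omega)
    rw [map_sub, sub_eq_zero] at this
    rw [map_sub, PowerSeries.coeff_mk, sub_eq_zero, ← this]
    congr 2
    omega
  have hg0 : g.constantCoeff = 0 := by
    have := PowerSeries.X_pow_dvd_iff.1 (hga 1) 0 (by omega)
    simpa [a0 1] using this
  refine ⟨g, hg0, ?_⟩
  have hfix : Φ g - g = 0 := by
    ext m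
    rw [map_zero]
    have h1 : PowerSeries.X ^ (m + 1) ∣ Φ g - Φ (a m) := key m _ _ hg0 (a0 m) (hga m)
    have h2 := hga (m + 1)
    rw [a_succ] at h2
    have := dvd_sub h1 h2
    rw [sub_sub_sub_cancel_right] at this
    exact PowerSeries.X_pow_dvd_iff.1 this m (by omega)
  simpa [Φ] using hfix

lemma hasSubst_points {σ : Type v} (F : FormalGroup R) (p q : F.Point σ) :
    HasSubst ![p.val, q.val] :=
  hasSubst_of_constantCoeff_nilpotent (by intro s; fin_cases s <;> [exact p.2; exact q.2])

lemma exists_point_neg {σ : Type v} (F : FormalGroup R) [F.IsComm] (p : F.Point σ) :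
    ∃ q : F.Point σ, q + p = 0 := by
  obtain ⟨g, hg, h⟩ := exists_formal_neg F
  have hp : HasSubst (fun _ : Unit => p.val) := PowerSeries.HasSubst.const p.2
  have hX : HasSubst ![(PowerSeries.X : PowerSeries R), g] :=
    hasSubst_of_constantCoeff_zero (by
      intro s; fin_cases s
      · exact PowerSeries.constantCoeff_X
      · exact hg)
  let q : F.Point σ := ⟨g.subst p.val, IsNilpotent_subst hp (by
    change IsNilpotent g.constantCoeff
    rw [hg]; exact IsNilpotent.zero)⟩
  refine ⟨q, ?_⟩
  rw [add_comm]
  apply Subtype.ext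
  have h2 := congrArg (PowerSeries.subst p.val) h
  rw [PowerSeries.subst, PowerSeries.subst, subst_comp_subst_apply hX hp] at h2
  rw [FormalGroup.add_apply, FormalGroup.zero_apply]
  refine Eq.trans (congrArg (fun a => subst a F.toPowerSeries) ?_)
    (h2.trans (by rw [← coe_substAlgHom hp, map_zero]))
  funext s
  fin_cases s
  · exact (PowerSeries.subst_X p.2).symm
  · rfl

/-- The points of a commutative formal group law form an abelian group. -/
instance {σ : Type v} (F : FormalGroup R) [F.IsComm] : AddCommGroup (F.Point σ) :=
  letI : Neg (F.Point σ) := ⟨fun p => (exists_point_neg F p).choose⟩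
  { (inferInstance : AddCommMonoid (F.Point σ)) with
    zsmul := zsmulRec
    neg_add_cancel := fun p => (exists_point_neg F p).choose_spec }

section FormalGroupAlgebra

variable {M κ : Type v} [AddCommGroup M]
  (F : FormalGroup R) [F.IsComm] (B : Module.Basis κ ℤ M)

/-- The variable `x_i` as a point of the formal group. -/
def varPoint {κ : Type v} (F : FormalGroup R) (i : κ) : F.Point κ :=
  ⟨X i, by change IsNilpotent (constantCoeff (X i)); rw [constantCoeff_X]; exact IsNilpotent.zero⟩

/-- The group homomorphism `λ ↦ x_λ` from the lattice to the points of the formal group: it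
sends the `i`-th basis vector to the `i`-th variable, so that
`x_{λ + μ} = F (x_λ, x_μ)` and `x_0 = 0`. -/
def charPoint : M →ₗ[ℤ] F.Point κ :=
  B.constr ℤ (varPoint F)

/-- The element `x_λ` of the formal group algebra `R⟦x_i : i ∈ κ⟧`. -/
def formalChar (l : M) : MvPowerSeries κ R := (charPoint F B l).val

lemma formalChar_basis (i : κ) : formalChar F B (B i) = X i := by
  rw [formalChar, charPoint, Module.Basis.constr_basis]
  rfl

lemma formalChar_add (l m : M) : formalChar F B (l + m) =
    F.toPowerSeries.subst ![formalChar F B l, formalChar F B m] := by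
  simp [formalChar]

variable [Finite κ]

lemma hasSubst_formalChar (u : M →ₗ[ℤ] M) : HasSubst fun i => formalChar F B (u (B i)) :=
  hasSubst_of_constantCoeff_nilpotent fun i => (charPoint F B (u (B i))).2

/-- The endomorphism of the formal group algebra induced by an endomorphism `u` of the lattice:
the continuous homomorphism of `R`-algebras with `x_λ ↦ x_{u λ}`. -/
def formalMap (u : M →ₗ[ℤ] M) : MvPowerSeries κ R →ₐ[R] MvPowerSeries κ R :=
  substAlgHom (hasSubst_formalChar F B u)

/-- Substitution on points of the formal group. -/
def substPoint {a : κ → MvPowerSeries κ R} (ha : HasSubst a) : F.Point κ →+ F.Point κ where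
  toFun p := ⟨p.val.subst a, IsNilpotent_subst ha p.2⟩
  map_zero' := Subtype.ext (by
    change subst a (0 : MvPowerSeries κ R) = 0
    rw [← coe_substAlgHom ha, map_zero])
  map_add' p q := Subtype.ext (by
    change subst a (subst ![p.val, q.val] F.toPowerSeries) = subst ![_, _] F.toPowerSeries
    rw [subst_comp_subst_apply (hasSubst_points F p q) ha]
    congr 1
    funext s
    fin_cases s <;> rfl)

lemma formalMap_formalChar (u : M →ₗ[ℤ] M) (l : M) :
    formalMap F B u (formalChar F B l) = formalChar F B (u l) := by
  have h : (substPoint F (hasSubst_formalChar F B u)).toIntLinearMap ∘ₗ charPoint F B =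
      charPoint F B ∘ₗ u := by
    refine B.ext fun i => Subtype.ext ?_
    change subst _ (formalChar F B (B i)) = formalChar F B (u (B i))
    rw [formalChar_basis, subst_X (hasSubst_formalChar F B u)]
  have h2 := congrArg Subtype.val (LinearMap.congr_fun h l)
  rw [formalMap, coe_substAlgHom]
  exact h2

lemma formalMap_id (f : MvPowerSeries κ R) : formalMap F B LinearMap.id f = f := by
  rw [formalMap, coe_substAlgHom]
  simp only [LinearMap.id_apply, formalChar_basis]
  exact congrFun subst_self f

lemma formalMap_comp (u w : M →ₗ[ℤ] M) (f : MvPowerSeries κ R) :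
    formalMap F B (u ∘ₗ w) f = formalMap F B u (formalMap F B w f) := by
  have h : ∀ i, subst (fun i => formalChar F B (u (B i))) (formalChar F B (w (B i))) =
      formalChar F B ((u ∘ₗ w) (B i)) := fun i => by
    have := formalMap_formalChar F B u (w (B i))
    rwa [formalMap, coe_substAlgHom] at this
  simp only [formalMap, coe_substAlgHom]
  rw [subst_comp_subst_apply (hasSubst_formalChar F B w) (hasSubst_formalChar F B u)]
  simp only [h]

end FormalGroupAlgebra

section Polynomial

variable (R) {M : Type v} [AddCommGroup M] (c : R)

/-- The ideal of `R[x_λ : λ ∈ M]` generated by `x_0` and by all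
`x_{λ + μ} - (x_λ + x_μ - c x_λ x_μ)`. -/
def connectiveIdeal (M : Type v) [AddCommGroup M] (c : R) : Ideal (MvPolynomial M R) :=
  Ideal.span ({MvPolynomial.X 0} ∪ Set.range fun p : M × M =>
    MvPolynomial.X (p.1 + p.2) - (MvPolynomial.X p.1 + MvPolynomial.X p.2
      - MvPolynomial.C c * MvPolynomial.X p.1 * MvPolynomial.X p.2))

variable {R}

lemma connectiveIdeal_le_comap (u : M →ₗ[ℤ] M) :
    connectiveIdeal R M c ≤
      (connectiveIdeal R M c).comap (MvPolynomial.rename u : _ →ₐ[R] MvPolynomial M R) := by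
  refine Ideal.span_le.2 ?_
  rintro _ (rfl | ⟨⟨l, m⟩, rfl⟩)
  · refine Ideal.subset_span (Or.inl ?_)
    simp
  · refine Ideal.subset_span (Or.inr ⟨(u l, u m), ?_⟩)
    simp

/-- The endomorphism `x_λ ↦ x_{u λ}` of `R[x_λ : λ ∈ M]` modulo the relations. -/
def connectiveMap (u : M →ₗ[ℤ] M) :
    (MvPolynomial M R ⧸ connectiveIdeal R M c) →ₐ[R] (MvPolynomial M R ⧸ connectiveIdeal R M c) :=
  Ideal.quotientMapₐ _ (MvPolynomial.rename u) (connectiveIdeal_le_comap c u)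

lemma connectiveMap_id (f : MvPolynomial M R ⧸ connectiveIdeal R M c) :
    connectiveMap c LinearMap.id f = f := by
  obtain ⟨f, rfl⟩ := Ideal.Quotient.mk_surjective f
  simp [connectiveMap]

lemma connectiveMap_comp (u w : M →ₗ[ℤ] M) (f : MvPolynomial M R ⧸ connectiveIdeal R M c) :
    connectiveMap c (u ∘ₗ w) f = connectiveMap c u (connectiveMap c w f) := by
  obtain ⟨f, rfl⟩ := Ideal.Quotient.mk_surjective f
  simp [connectiveMap, MvPolynomial.rename_rename]

end Polynomial

section Roots

variable {ι M N : Type v} [AddCommGroup M] [AddCommGroup N]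

/-- The root datum is indecomposable: its roots cannot be split into two nonempty mutually
orthogonal parts. -/
def Indecomposable (P : RootPairing ι ℤ M N) : Prop :=
  ∀ s : Set ι, s.Nonempty → (∀ i ∈ s, ∀ j ∉ s, P.pairing i j = 0) → s = Set.univ

/-- `θ` is (the index of) the highest root with respect to the base `b`: for every root `α`, the
difference `θ - α` is a sum of simple roots. -/
def IsHighestRoot {P : RootPairing ι ℤ M N} (b : P.Base) (θ : ι) : Prop :=
  ∀ i, P.root θ - P.root i ∈ AddSubmonoid.closure (P.root '' b.support)

variable (P : RootPairing ι ℤ M N)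

/-- The action of a Weyl group element on characters. -/
def weylMap (w : P.weylGroup) : M →ₗ[ℤ] M :=
  (RootPairing.Equiv.weightEquiv P P w.1).toLinearMap

lemma weylMap_apply (w : P.weylGroup) (l : M) : weylMap P w l = w • l := rfl

lemma weylMap_one : weylMap P 1 = LinearMap.id := rfl

lemma weylMap_mul (w w' : P.weylGroup) : weylMap P (w * w') = weylMap P w ∘ₗ weylMap P w' := rfl

/-- The action of the Weyl group on the cocharacter lattice, contragredient to the action on
characters. -/
def weylCoaction : P.weylGroup →* MulAut (Multiplicative N) where
  toFun w := AddEquiv.toMultiplicative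
    (RootPairing.Equiv.coweightEquiv P P (w⁻¹ : P.weylGroup).1).toAddEquiv
  map_one' := by
    ext n
    rw [inv_one]
    rfl
  map_mul' w w' := by
    ext n
    rw [mul_inv_rev]
    rfl

/-- The affine Weyl group `W_a`: the semidirect product of the Weyl group with the group of
translations by the coroot lattice (which is `N` when the coroots span `N`). -/
abbrev AffineWeylGroup := Multiplicative N ⋊[weylCoaction P] P.weylGroup

/-- The translation `t_{α^∨}` by the coroot of the `i`-th root `α`. -/
def translation (i : ι) : AffineWeylGroup P :=
  SemidirectProduct.inl (Multiplicative.ofAdd (P.coroot i))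

/-- The reflection `s_α` in the `i`-th root `α`. -/
def rootReflection (i : ι) : AffineWeylGroup P :=
  SemidirectProduct.inr (RootPairing.weylGroup.ofIdx P i)

/-- The simple affine reflection `s_0 = s_{-θ + δ} = t_{θ^∨} s_θ`. -/
def affineRefl (θ : ι) : AffineWeylGroup P := translation P θ * rootReflection P θ

/-- A commutative ring with an action of the Weyl group and with elements `x_λ`, for `λ` in the
character lattice, that are permuted accordingly. -/
structure Coefficients where
  /-- the ring `S` -/
  carrier : Type (max u v)
  [commRing : CommRing carrier]
  [action : MulSemiringAction P.weylGroup carrier]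
  /-- the elements `x_λ` -/
  x : M → carrier
  smul_x : ∀ (w : P.weylGroup) (l : M), w • x l = x (w • l)

attribute [instance] Coefficients.commRing Coefficients.action

variable {R : Type u} [CommRing R]

/-- The formal group algebra `S` of the character lattice `M` for the commutative formal group law
`F`: given a basis of `M`, the ring of power series `R⟦x_i : i ∈ κ⟧`, in which the `x_λ` are
determined by `x_{λ + μ} = F (x_λ, x_μ)`. The Weyl group acts by continuous automorphisms of
`R`-algebras, with `w • x_λ = x_{w λ}`. -/
def formalCoefficients {κ : Type v} [Finite κ] (B : Module.Basis κ ℤ M) (F : FormalGroup R)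
    [F.IsComm] : Coefficients.{u, v} P where
  carrier := MvPowerSeries κ R
  action :=
    { smul := fun w f => formalMap F B (weylMap P w) f
      one_smul := formalMap_id F B
      mul_smul := fun w w' f => formalMap_comp F B (weylMap P w) (weylMap P w') f
      smul_zero := fun w => map_zero (formalMap F B (weylMap P w))
      smul_add := fun w => map_add (formalMap F B (weylMap P w))
      smul_one := fun w => map_one (formalMap F B (weylMap P w))
      smul_mul := fun w => map_mul (formalMap F B (weylMap P w)) }
  x := formalChar F B
  smul_x w l := formalMap_formalChar F B (weylMap P w) l

/-- The polynomial version of `S` for the connective formal group law `x + y - c x y`: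
`R[x_λ : λ ∈ M]` modulo `x_0` and all `x_{λ + μ} - (x_λ + x_μ - c x_λ x_μ)`, with the Weyl group
acting by `w • x_λ = x_{w λ}`. -/
def connectiveCoefficients (c : R) : Coefficients.{u, v} P where
  carrier := MvPolynomial M R ⧸ connectiveIdeal R M c
  action :=
    { smul := fun w f => connectiveMap c (weylMap P w) f
      one_smul := connectiveMap_id c
      mul_smul := fun w w' f => connectiveMap_comp c (weylMap P w) (weylMap P w') f
      smul_zero := fun w => map_zero (connectiveMap c (weylMap P w))
      smul_add := fun w => map_add (connectiveMap c (weylMap P w))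
      smul_one := fun w => map_one (connectiveMap c (weylMap P w))
      smul_mul := fun w => map_mul (connectiveMap c (weylMap P w)) }
  x l := Ideal.Quotient.mk _ (MvPolynomial.X l)
  smul_x w l := by
    change connectiveMap c (weylMap P w) _ = _
    simp [connectiveMap, weylMap_apply]

end Roots

variable (R) in
/-- The choices of a theory over `R`: a commutative one-dimensional formal group law with the power
series version of `S`, or a connective formal group law `x + y - c x y` with the polynomial
version of `S`. -/
inductive Theory : Type u
  | formal (F : FormalGroup R) (hF : F.IsComm)
  | connective (c : R)

section Demazure

variable {ι M N : Type v} [AddCommGroup M] [AddCommGroup N]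

/-- The ring `S`, with its Weyl group action and its elements `x_λ`, for the given theory. -/
def Theory.coefficients {κ : Type v} [Finite κ] (h : Theory R) (P : RootPairing ι ℤ M N)
    (B : Module.Basis κ ℤ M) : Coefficients.{u, v} P :=
  match h with
  | .formal F _ => formalCoefficients P B F
  | .connective c => connectiveCoefficients P c

variable {P : RootPairing ι ℤ M N} (A : Coefficients.{u, v} P)

/-- The multiplicative set generated by the `x_α`, for all roots `α`. -/
def rootSubmonoid : Submonoid A.carrier :=
  Submonoid.closure (Set.range fun i => A.x (P.root i))

/-- The ring `Q = S[1 / x_α : α ∈ Φ]`. -/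
abbrev RootLocalization := Localization (rootSubmonoid A)

lemma rootSubmonoid_le_comap (w : P.weylGroup) :
    rootSubmonoid A ≤
      (rootSubmonoid A).comap (MulSemiringAction.toRingHom P.weylGroup A.carrier w) := by
  refine Submonoid.closure_le.2 ?_
  rintro _ ⟨i, rfl⟩
  refine Submonoid.subset_closure ⟨P.weylGroupToPerm w i, ?_⟩
  change A.x _ = w • A.x _
  rw [A.smul_x, RootPairing.weylGroup_apply_root]

/-- The action of a Weyl group element on `Q`, extending the one on `S`. -/
def localizationMap (w : P.weylGroup) : RootLocalization A →+* RootLocalization A :=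
  IsLocalization.map (RootLocalization A) (MulSemiringAction.toRingHom P.weylGroup A.carrier w)
    (rootSubmonoid_le_comap A w)

lemma localizationMap_algebraMap (w : P.weylGroup) (s : A.carrier) :
    localizationMap A w (algebraMap A.carrier (RootLocalization A) s) =
      algebraMap A.carrier (RootLocalization A) (w • s) :=
  IsLocalization.map_eq _ s

instance : MulSemiringAction P.weylGroup (RootLocalization A) where
  smul w q := localizationMap A w q
  one_smul q := by
    have h : localizationMap A 1 = RingHom.id _ :=
      IsLocalization.ringHom_ext (rootSubmonoid A) (RingHom.ext fun s => by
        simp [localizationMap_algebraMap])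
    exact RingHom.congr_fun h q
  mul_smul w w' q := by
    have h : localizationMap A (w * w') = (localizationMap A w).comp (localizationMap A w') :=
      IsLocalization.ringHom_ext (rootSubmonoid A) (RingHom.ext fun s => by
        simp [localizationMap_algebraMap, mul_smul])
    exact RingHom.congr_fun h q
  smul_zero w := map_zero (localizationMap A w)
  smul_add w := map_add (localizationMap A w)
  smul_one w := map_one (localizationMap A w)
  smul_mul w := map_mul (localizationMap A w)

/-- The affine Weyl group acts on `Q` through its quotient `W`: translations act trivially. -/
instance : MulSemiringAction (AffineWeylGroup P) (RootLocalization A) :=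
  MulSemiringAction.compHom _ SemidirectProduct.rightHom

/-- The twisted group algebra `Q_{W_a}`, the free left `Q`-module with basis `η_w` and with product
`c η_w * c' η_{w'} = c w(c') η_{w w'}`. -/
abbrev TwistedGroupAlgebra := SkewMonoidAlgebra (RootLocalization A) (AffineWeylGroup P)

/-- The basis element `η_w`. -/
def eta (w : AffineWeylGroup P) : TwistedGroupAlgebra A := SkewMonoidAlgebra.single w 1

/-- The element `1 / x_α` of `Q`, for the `i`-th root `α`. -/
def invX (i : ι) : RootLocalization A :=
  Localization.mk 1 ⟨A.x (P.root i), Submonoid.subset_closure ⟨i, rfl⟩⟩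

/-- The Demazure element `X_α = (1 / x_α) (1 - η_{s_α})`, for the `i`-th root `α`. -/
def demazureElement (i : ι) : TwistedGroupAlgebra A := invX A i • (1 - eta A (rootReflection P i))

/-- The Demazure element `X_0 = (1 / x_{-θ}) (1 - η_{s_0})`. The index of `-θ = s_θ(θ)` is
`P.reflectionPerm θ θ`. -/
def affineDemazureElement (θ : ι) : TwistedGroupAlgebra A :=
  invX A (P.reflectionPerm θ θ) • (1 - eta A (affineRefl P θ))

/-- The formal affine Demazure algebra `D_{W_a}` for the small torus: the subring of `Q_{W_a}`
generated by `S` (embedded as `s ↦ s η_1`), by the `X_α` for the simple roots `α`, and by `X_0`. -/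
def demazureAlgebra (b : P.Base) (θ : ι) : Subring (TwistedGroupAlgebra A) :=
  Subring.closure
    (Set.range (fun s : A.carrier => s • (1 : TwistedGroupAlgebra A)) ∪
      demazureElement A '' b.support ∪ {affineDemazureElement A θ})

lemma smul_mul_twisted {T : Type*} [DistribSMul T (RootLocalization A)]
    [IsScalarTower T (RootLocalization A) (RootLocalization A)]
    (q : T) (y z : TwistedGroupAlgebra A) : (q • y) * z = q • (y * z) := by
  induction y using SkewMonoidAlgebra.induction_on with
  | zero => simp
  | add y y' h h' => rw [smul_add, add_mul, add_mul, smul_add, h, h']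
  | single g a =>
    induction z using SkewMonoidAlgebra.induction_on with
    | zero => simp
    | add z z' h h' => rw [mul_add, mul_add, smul_add, h, h']
    | single g' a' =>
      simp only [SkewMonoidAlgebra.smul_single, SkewMonoidAlgebra.single_mul_single,
        smul_mul_assoc]

/-- `D_{W_a}` as a left `S`-module. -/
def demazureModule (b : P.Base) (θ : ι) : Submodule A.carrier (TwistedGroupAlgebra A) where
  carrier := demazureAlgebra A b θ
  zero_mem' := zero_mem _
  add_mem' := add_mem
  smul_mem' s z hz := by
    have h : s • z = (s • (1 : TwistedGroupAlgebra A)) * z := by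
      rw [smul_mul_twisted, one_mul]
    rw [h]
    exact mul_mem (Subring.subset_closure (Or.inl (Or.inl ⟨s, rfl⟩))) hz

/-- The dual `Q_{W_a}^* = Hom_Q (Q_{W_a}, Q)`. -/
abbrev TwistedDual := TwistedGroupAlgebra A →ₗ[RootLocalization A] RootLocalization A

/-- The dual `D_{W_a}^* = Hom_S (D_{W_a}, S)`. -/
abbrev DemazureDual (b : P.Base) (θ : ι) := demazureModule A b θ →ₗ[A.carrier] A.carrier

/-- `f : Q_{W_a} → Q` extends `φ : D_{W_a} → S`. -/
def Extends {A : Coefficients.{u, v} P} {b : P.Base} {θ : ι} (f : TwistedDual A)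
    (φ : DemazureDual A b θ) : Prop :=
  ∀ z : demazureModule A b θ, f z = algebraMap A.carrier (RootLocalization A) (φ z)

/-- `D_{W_a}^*` as a subset of `Q_{W_a}^*`. -/
def demazureDual (b : P.Base) (θ : ι) : Set (TwistedDual A) :=
  {f | ∃ φ : DemazureDual A b θ, Extends f φ}

/-- The right Hecke action `(z • f) (y) = f (y z)` of `Q_{W_a}` on its dual. -/
def heckeAction {A : Coefficients.{u, v} P} (z : TwistedGroupAlgebra A) (f : TwistedDual A) :
    TwistedDual A where
  toFun y := f (y * z)
  map_add' y y' := by rw [add_mul, map_add]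
  map_smul' q y := by rw [smul_mul_twisted, map_smul, RingHom.id_apply]

/-- The `W`-invariants of `Q_{W_a}^*`, for the right Hecke action of the `η_w` with `w ∈ W`. -/
def weylInvariants : Set (TwistedDual A) :=
  {f | ∀ w : P.weylGroup, heckeAction (eta A (SemidirectProduct.inr w)) f = f}

/-- The element `q` of `Q` lies in `s S`. -/
def MemMultiples {A : Coefficients.{u, v} P} (s : A.carrier) (q : RootLocalization A) : Prop :=
  ∃ a : A.carrier, q = algebraMap A.carrier (RootLocalization A) (s * a)

end Demazure

end AffineDemazure

end

open AffineDemazure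

/-! For all roots `α`, the elements `Z_α = (1 / x_α) (1 - η_{t_{α^∨}})` and
`X_α = (1 / x_α) (1 - η_{s_α})` lie in `D_{W_a}`, and so do all `η_w`, because `W_a` is generated by
the simple reflections and `s_0` and because every root is conjugate to the highest root `θ` or to a
root that takes the value `1` on `θ^∨` (`eta_mem_demazureAlgebra`, `demazureElement_mem`, `translationElement_mem`). The conditions
of the theorem say exactly that `f` is `S`-valued on the products `Z_α ^ d η_w` and
`Z_α ^ d X_α η_w`. So they hold for the elements of `D_{W_a}^*`.

Conversely, fix a root `α` and invert all `x_β` with `β ≠ ±α`, which gives the subring `S_α` of `Q`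
(`localCoefficients`). The `S_α`-span of the products `Z_α ^ d η_w` and `Z_α ^ d X_α η_w`
(`straightModule`) contains `D_{W_a}` (`demazureAlgebra_le_straightModule`). Indeed, computations in
rank one show that left multiplication by `X_α`, `Z_α` and `η_{t_{α^∨}}^{±1}` preserves it. A generator
`(1 / x_β) (1 - η_s)` of `D_{W_a}` to the right of `η_w` moves to its left at the cost of conjugating
the affine reflection `s` by `w`. If the root of the new reflection is `±α`, the generator becomes
an `S`-combination of products of these operators; otherwise its denominator is invertible in
`S_α`. Hence a form `f` that satisfies the conditions maps `D_{W_a}` to the intersection of all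
`S_α`, which is `S` because the `x_α` are pairwise coprime
(`exists_algebraMap_eq_of_forall_mem_localCoefficients`). For a pair of roots one of which is not
divisible by `2` in the character lattice, this coprimality is automatic: the line spanned by such a
root has a complement in the lattice, and the projection to it induces a retraction of `S` with
kernel generated by `x_α` (`x_root_dvd_of_dvd_mul_of_eq_one`).

A form that is invariant under `W` does not distinguish `s_α t_n` from `t_{n - ⟨α, n⟩ α^∨}`, so that
the conditions on `1 - η_{s_α}` follow from those on `1 - η_{t_{α^∨}}`
(`memMultiples_of_mem_weylInvariants`). -/

noncomputable section

namespace AffineDemazure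

/-! ### Power series and formal group laws -/

section PowerSeries

open MvPowerSeries

variable {R : Type u} [CommRing R]

/-- A power series that vanishes when the variable `X s` is set to `0` is a multiple of `X s`. -/
lemma X_dvd_of_subst_update_eq_zero {σ : Type v} [Finite σ] [DecidableEq σ] (s : σ)
    {f : MvPowerSeries σ R}
    (h : f.subst (Function.update (X : σ → MvPowerSeries σ R) s 0) = (0 : MvPowerSeries σ R)) :
    X s ∣ f := by
  have ha : HasSubst (Function.update (X : σ → MvPowerSeries σ R) s 0) :=
    hasSubst_of_constantCoeff_zero fun i => by
      by_cases hi : i = s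
      · subst hi; simp
      · simp [Function.update_of_ne hi]
  cases nonempty_fintype σ
  have hprod : ∀ d : σ →₀ ℕ, (d.prod fun t e =>
      Function.update (X : σ → MvPowerSeries σ R) s 0 t ^ e) =
        if d s = 0 then monomial d 1 else 0 := by
    intro d
    rw [Finsupp.prod_fintype _ _ (by simp)]
    split_ifs with hd
    · rw [monomial_one_eq, Finsupp.prod_fintype _ _ (by simp)]
      refine Finset.prod_congr rfl fun i _ => ?_
      by_cases hi : i = s
      · subst hi; simp [hd]
      · simp [Function.update_of_ne hi]
    · exact Finset.prod_eq_zero (Finset.mem_univ s) (by simp [hd])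
  rw [X_dvd_iff]
  intro m hm
  have h1 := congrArg (coeff m) h
  rw [coeff_subst ha, map_zero, finsum_eq_single _ m] at h1
  · simpa [hprod, hm] using h1
  · intro d hd
    rw [hprod]
    split_ifs
    · rw [coeff_monomial_ne hd.symm, smul_zero]
    · rw [map_zero, smul_zero]

/-- Substitution respects congruences modulo a power series `g` without constant term. Since ideals
need not be closed, this is not a matter of approximation by polynomials: one replaces `g` by a
new variable. -/
lemma dvd_subst_sub_self {κ : Type v} [Finite κ] {g : MvPowerSeries κ R}
    (hg : constantCoeff g = 0) {a : κ → MvPowerSeries κ R} (h : ∀ i, g ∣ a i - X i)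
    (f : MvPowerSeries κ R) : g ∣ f.subst a - f := by
  classical
  choose q hq using h
  let ξ : κ → MvPowerSeries (Option κ) R := fun i => X (some i)
  have hξ : HasSubst ξ := hasSubst_of_constantCoeff_zero fun i => by simp [ξ]
  let a' : κ → MvPowerSeries (Option κ) R := fun i => X (some i) + X none * (q i).subst ξ
  have ha' : HasSubst a' := hasSubst_of_constantCoeff_zero fun i => by simp [a']
  let k : Option κ → MvPowerSeries (Option κ) R := Function.update X none 0
  have hk0 : k none = 0 := by simp [k]
  have hk1 : ∀ i, k (some i) = X (some i) := fun i => by simp [k]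
  have hk : HasSubst k := hasSubst_of_constantCoeff_zero fun i => by
    cases i <;> simp [hk0, hk1]
  let c : Option κ → MvPowerSeries κ R := fun o => o.elim g X
  have hc : HasSubst c := hasSubst_of_constantCoeff_zero fun i => by
    cases i <;> simp [c, hg]
  have hξc : (fun i => (ξ i).subst c) = (X : κ → MvPowerSeries κ R) := by
    funext i
    simp [ξ, subst_X hc, c]
  have hdvd : X none ∣ f.subst a' - f.subst ξ := by
    apply X_dvd_of_subst_update_eq_zero
    change subst k _ = _
    rw [subst_sub hk, subst_comp_subst_apply ha' hk, subst_comp_subst_apply hξ hk, sub_eq_zero]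
    congr 1
    funext i
    simp [a', ξ, subst_add hk, subst_mul hk, subst_X hk, hk0, hk1]
  obtain ⟨r, hr⟩ := hdvd
  refine ⟨r.subst c, ?_⟩
  have h1 := congrArg (subst c) hr
  rw [subst_sub hc, subst_comp_subst_apply ha' hc, subst_comp_subst_apply hξ hc, hξc,
    subst_mul hc, subst_X hc, subst_self] at h1
  have h2 : (fun i => (a' i).subst c) = a := by
    funext i
    have : ((q i).subst ξ).subst c = q i := by
      rw [subst_comp_subst_apply hξ hc, hξc, subst_self]
      rfl
    simp only [a', subst_add hc, subst_mul hc, subst_X hc, this]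
    change X i + g * q i = a i
    rw [← hq]
    ring
  rw [h2] at h1
  exact h1

/-- A formal group law has the form `X + Y + X Y G`. -/
lemma exists_formalGroup_eq (F : FormalGroup R) :
    ∃ G : MvPowerSeries (Fin 2) R, F.toPowerSeries = X 0 + X 1 + X 0 * X 1 * G := by
  classical
  have hX : ∀ i : Fin 2, PowerSeries.HasSubst (X i : MvPowerSeries (Fin 2) R) := fun i => by
    change IsNilpotent (constantCoeff (X i))
    simp
  have e0 : Function.update (X : Fin 2 → MvPowerSeries (Fin 2) R) 0 0 = ![0, X 1] := by
    funext i; fin_cases i <;> simp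
  have e1 : Function.update (X : Fin 2 → MvPowerSeries (Fin 2) R) 1 0 = ![X 0, 0] := by
    funext i; fin_cases i <;> simp
  have h0 : HasSubst ![(0 : MvPowerSeries (Fin 2) R), X 1] := HasSubst.zero_X
  have h1 : HasSubst ![(X 0 : MvPowerSeries (Fin 2) R), 0] := HasSubst.X_zero
  obtain ⟨H, hH⟩ : X 0 ∣ F.toPowerSeries - X 0 - X 1 := by
    apply X_dvd_of_subst_update_eq_zero
    rw [e0, subst_sub h0, subst_sub h0, F.zero_add (hX 1), subst_X h0, subst_X h0]
    simp
  obtain ⟨G, hG⟩ : X 1 ∣ H := by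
    apply X_dvd_of_subst_update_eq_zero
    have := congrArg (subst (Function.update (X : Fin 2 → MvPowerSeries (Fin 2) R) 1 0)) hH
    rw [e1, subst_sub h1, subst_sub h1, F.add_zero (hX 0), subst_X h1, subst_X h1,
      subst_mul h1, subst_X h1] at this
    simp only [Matrix.cons_val_zero, Matrix.cons_val_one, sub_self] at this
    rw [e1]
    have h2 : X 0 * subst ![X 0, 0] H = X 0 * (0 : MvPowerSeries (Fin 2) R) := by
      rw [mul_zero, ← this]
    rw [← sub_eq_zero, ← mul_sub, sub_zero] at h2
    ext m
    have := congrArg (coeff (m + Finsupp.single 0 1)) h2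
    rw [map_zero] at this ⊢
    rwa [add_comm, X_def, coeff_add_monomial_mul, one_mul] at this
  refine ⟨G, ?_⟩
  rw [mul_assoc, ← hG, ← hH]
  ring

variable {M κ : Type v} [AddCommGroup M]
  (F : FormalGroup R) [F.IsComm] (B : Module.Basis κ ℤ M)

lemma formalChar_zero : formalChar F B 0 = 0 := by
  simp [formalChar]

lemma formalChar_add_eq (l m : M) : ∃ g, formalChar F B (l + m) =
    formalChar F B l + formalChar F B m + formalChar F B l * formalChar F B m * g := by
  obtain ⟨G, hG⟩ := exists_formalGroup_eq F
  have h : HasSubst ![formalChar F B l, formalChar F B m] :=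
    hasSubst_points F (charPoint F B l) (charPoint F B m)
  refine ⟨G.subst ![formalChar F B l, formalChar F B m], ?_⟩
  rw [formalChar_add, hG]
  simp [subst_add h, subst_mul h, subst_X h]

variable [IsDomain R]

lemma constantCoeff_formalChar (l : M) : constantCoeff (formalChar F B l) = 0 :=
  IsNilpotent.eq_zero (charPoint F B l).2

/-- The linear part of `x_λ` is `λ` itself. -/
lemma coeff_single_formalChar (l : M) (i : κ) :
    coeff (Finsupp.single i 1) (formalChar F B l) = (B.repr l i : R) := by
  classical
  have hmul : ∀ f g : MvPowerSeries κ R, constantCoeff f = 0 → constantCoeff g = 0 →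
      coeff (Finsupp.single i 1) (f * g) = 0 := by
    intro f g hf hg
    rw [coeff_mul, Finsupp.antidiagonal_single, Finset.sum_map]
    refine Finset.sum_eq_zero fun p hp => ?_
    have h1 : p = (0, 1) ∨ p = (1, 0) := by
      have := Finset.HasAntidiagonal.mem_antidiagonal.1 hp
      rcases p with ⟨a, b⟩
      simp only [Prod.mk.injEq]
      simp only at this
      omega
    rcases h1 with rfl | rfl <;> simp [hf, hg]
  let φ : M →+ R :=
    { toFun := fun l => coeff (Finsupp.single i 1) (formalChar F B l)
      map_zero' := by rw [formalChar_zero, map_zero]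
      map_add' := fun l m => by
        obtain ⟨g, hg⟩ := formalChar_add_eq F B l m
        rw [hg, mul_assoc, map_add, map_add, hmul _ _ (constantCoeff_formalChar F B l)
          (by rw [map_mul, constantCoeff_formalChar, zero_mul]), add_zero] }
  let ψ : M →+ R :=
    (Int.castAddHom R).comp ((Finsupp.applyAddHom i).comp B.repr.toLinearMap.toAddMonoidHom)
  have h : φ.toIntLinearMap = ψ.toIntLinearMap := by
    refine B.ext fun j => ?_
    change coeff (Finsupp.single i 1) (formalChar F B (B j)) = ((B.repr (B j) i : ℤ) : R)
    rw [formalChar_basis, coeff_X, Module.Basis.repr_self]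
    by_cases hij : i = j
    · subst hij; simp
    · rw [if_neg, Finsupp.single_eq_of_ne hij, Int.cast_zero]
      intro h
      exact hij (Finsupp.single_left_injective one_ne_zero h)
  exact LinearMap.congr_fun h l

lemma formalChar_ne_zero [CharZero R] {l : M} (hl : l ≠ 0) : formalChar F B l ≠ 0 := by
  intro h
  apply hl
  apply B.repr.injective
  ext i
  have := coeff_single_formalChar F B l i
  rw [h, map_zero] at this
  rw [map_zero, Finsupp.zero_apply]
  exact_mod_cast this.symm

lemma dvd_formalMap_sub [Finite κ] (u : M →ₗ[ℤ] M) {m : M}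
    (h : ∀ l, formalChar F B m ∣ formalChar F B (u l) - formalChar F B l)
    (f : MvPowerSeries κ R) : formalChar F B m ∣ formalMap F B u f - f := by
  rw [formalMap, coe_substAlgHom]
  refine dvd_subst_sub_self (constantCoeff_formalChar F B m) (fun i => ?_) f
  simpa [formalChar_basis] using h (B i)

end PowerSeries

/-! ### The polynomial algebra of the connective formal group law -/

section Connective

open MvPowerSeries

variable {R : Type u} [CommRing R] (c : R)

/-- The connective formal group law `X + Y - c X Y`. -/
def connectiveGroup : FormalGroup R where
  toPowerSeries := X 0 + X 1 - C c * X 0 * X 1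
  zero_constantCoeff := by simp
  lin_coeff_X := by
    rw [map_sub, map_add, mul_assoc, coeff_C_mul]
    simp [X, monomial_mul_monomial, coeff_monomial,
      Finsupp.single_left_inj (one_ne_zero : (1 : ℕ) ≠ 0)]
  lin_coeff_Y := by
    rw [map_sub, map_add, mul_assoc, coeff_C_mul]
    simp [X, monomial_mul_monomial, coeff_monomial,
      Finsupp.single_left_inj (one_ne_zero : (1 : ℕ) ≠ 0)]
  assoc := by
    have aux₁ := HasSubst.cons_subst_zero_left (f := (X 0 + X 1 - C c * X 0 * X 1 :
      MvPowerSeries (Fin 2) R)) (0 : Fin 3) 1 2 (by simp)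
    have aux₂ := HasSubst.cons_subst_zero_right (f := (X 0 + X 1 - C c * X 0 * X 1 :
      MvPowerSeries (Fin 2) R)) (0 : Fin 3) 1 2 (by simp)
    simp_rw [subst_sub aux₁, subst_add aux₁, subst_mul aux₁, subst_X aux₁, subst_sub aux₂,
      subst_add aux₂, subst_mul aux₂, subst_X aux₂]
    simp only [Nat.succ_eq_add_one, Nat.reduceAdd, subst_sub .X_X, subst_add .X_X, Fin.isValue,
      subst_X .X_X, Matrix.cons_val_zero, Matrix.cons_val_one, Matrix.cons_val_fin_one,
      subst_mul .X_X, subst_C]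
    ring

lemma connectiveGroup_subst {σ : Type v} {p q : MvPowerSeries σ R} (h : HasSubst ![p, q]) :
    (connectiveGroup c).toPowerSeries.subst ![p, q] = p + q - C c * p * q := by
  simp [connectiveGroup, subst_sub h, subst_add h, subst_mul h, subst_X h, subst_C]

instance : (connectiveGroup c).IsComm where
  comm := by
    rw [connectiveGroup_subst c .X_X]
    simp only [connectiveGroup]
    ring

variable (M : Type v) [AddCommGroup M]

/-- The ring `R[x_λ : λ ∈ M]` modulo `x_0` and all `x_{λ + μ} - (x_λ + x_μ - c x_λ x_μ)`. -/
abbrev ConnectiveAlgebra := MvPolynomial M R ⧸ connectiveIdeal R M c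

variable {M}

/-- The element `x_λ` of the connective algebra. -/
def connectiveChar (l : M) : ConnectiveAlgebra c M := Ideal.Quotient.mk _ (MvPolynomial.X l)

lemma connectiveChar_zero : connectiveChar c (0 : M) = 0 :=
  Ideal.Quotient.eq_zero_iff_mem.2 (Ideal.subset_span (Or.inl rfl))

lemma connectiveChar_add (l m : M) : connectiveChar c (l + m) =
    connectiveChar c l + connectiveChar c m -
      algebraMap R _ c * connectiveChar c l * connectiveChar c m :=
  (Ideal.Quotient.mk_eq_mk_iff_sub_mem _ _).2 (Ideal.subset_span (Or.inr ⟨(l, m), rfl⟩))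

lemma connectiveAlgebra_induction {p : ConnectiveAlgebra c M → Prop}
    (algebraMap : ∀ r : R, p (algebraMap R _ r)) (char : ∀ l, p (connectiveChar c l))
    (add : ∀ y z, p y → p z → p (y + z)) (mul : ∀ y z, p y → p z → p (y * z))
    (z : ConnectiveAlgebra c M) : p z := by
  obtain ⟨f, rfl⟩ := Ideal.Quotient.mk_surjective z
  induction f using MvPolynomial.induction_on with
  | C r => exact algebraMap r
  | add f g hf hg => rw [map_add]; exact add _ _ hf hg
  | mul_X f l hf => rw [map_mul]; exact mul _ _ hf (char l)

lemma connectiveMap_char (u : M →ₗ[ℤ] M) (l : M) :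
    connectiveMap c u (connectiveChar c l) = connectiveChar c (u l) := by
  simp [connectiveMap, connectiveChar]

lemma dvd_connectiveMap_sub (u : M →ₗ[ℤ] M) {a : ConnectiveAlgebra c M}
    (h : ∀ l, a ∣ connectiveChar c (u l) - connectiveChar c l) (z : ConnectiveAlgebra c M) :
    a ∣ connectiveMap c u z - z := by
  induction z using connectiveAlgebra_induction with
  | algebraMap r => simp
  | char l => rw [connectiveMap_char]; exact h l
  | add y z hy hz =>
    rw [map_add, add_sub_add_comm]
    exact dvd_add hy hz
  | mul y z hy hz =>
    rw [map_mul]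
    have e : connectiveMap c u y * connectiveMap c u z - y * z =
        (connectiveMap c u y - y) * connectiveMap c u z + y * (connectiveMap c u z - z) := by ring
    rw [e]
    exact dvd_add (hy.mul_right _) (hz.mul_left _)

variable {κ : Type v} (B : Module.Basis κ ℤ M)

/-- The comparison map from the polynomial to the power series version of the formal group
algebra of the connective formal group law. -/
def connectiveToFormal : ConnectiveAlgebra c M →ₐ[R] MvPowerSeries κ R :=
  Ideal.Quotient.liftₐ _ (MvPolynomial.aeval (formalChar (connectiveGroup c) B)) (by
    suffices h : connectiveIdeal R M c ≤ RingHom.ker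
        (MvPolynomial.aeval (R := R) (formalChar (connectiveGroup c) B)) from
      fun a ha => RingHom.mem_ker.1 (h ha)
    refine Ideal.span_le.2 ?_
    rintro _ (rfl | ⟨⟨l, m⟩, rfl⟩)
    · simp [formalChar_zero]
    · have h := (formalChar_add (connectiveGroup c) B l m).trans
        (connectiveGroup_subst c (hasSubst_points _ (charPoint _ B l) (charPoint _ B m)))
      change formalChar _ B (l + m) = formalChar _ B l + formalChar _ B m -
        C c * formalChar _ B l * formalChar _ B m at h
      simp [h, MvPowerSeries.algebraMap_apply])

lemma connectiveToFormal_char (l : M) :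
    connectiveToFormal c B (connectiveChar c l) = formalChar (connectiveGroup c) B l := by
  exact MvPolynomial.aeval_X (formalChar (connectiveGroup c) B) l

/-- Every element of the connective algebra becomes a polynomial in the `x_i`, where `i` runs
through a basis of the lattice, after multiplication by a unit that is itself such a polynomial:
one only has to clear the denominators of `x_{-i} = - x_i / (1 - c x_i)`. -/
lemma exists_unit_mul_mem_adjoin (z : ConnectiveAlgebra c M) :
    ∃ e ∈ Algebra.adjoin R (Set.range fun i => connectiveChar c (B i)), IsUnit e ∧
      e * z ∈ Algebra.adjoin R (Set.range fun i => connectiveChar c (B i)) := by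
  set T := Algebra.adjoin R (Set.range fun i => connectiveChar c (B i))
  have hadd : ∀ y z, (∃ e ∈ T, IsUnit e ∧ e * y ∈ T) → (∃ e ∈ T, IsUnit e ∧ e * z ∈ T) →
      ∃ e ∈ T, IsUnit e ∧ e * (y + z) ∈ T := by
    rintro y z ⟨e, he, hu, hy⟩ ⟨e', he', hu', hz⟩
    refine ⟨e * e', mul_mem he he', hu.mul hu', ?_⟩
    have : e * e' * (y + z) = e' * (e * y) + e * (e' * z) := by ring
    rw [this]
    exact add_mem (mul_mem he' hy) (mul_mem he hz)
  have hmul : ∀ y z, (∃ e ∈ T, IsUnit e ∧ e * y ∈ T) → (∃ e ∈ T, IsUnit e ∧ e * z ∈ T) →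
      ∃ e ∈ T, IsUnit e ∧ e * (y * z) ∈ T := by
    rintro y z ⟨e, he, hu, hy⟩ ⟨e', he', hu', hz⟩
    refine ⟨e * e', mul_mem he he', hu.mul hu', ?_⟩
    rw [mul_mul_mul_comm]
    exact mul_mem hy hz
  have hR : ∀ r : R, ∃ e ∈ T, IsUnit e ∧ e * algebraMap R _ r ∈ T := fun r =>
    ⟨1, one_mem _, isUnit_one, by rw [one_mul]; exact T.algebraMap_mem r⟩
  have hB : ∀ i, connectiveChar c (B i) ∈ T := fun i => Algebra.subset_adjoin ⟨i, rfl⟩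
  refine connectiveAlgebra_induction c hR (fun l => ?_) hadd hmul z
  have hl : l ∈ AddSubgroup.closure (Set.range B) := by
    have := B.mem_span l
    rwa [← AddSubgroup.toIntSubmodule_closure] at this
  induction hl using AddSubgroup.closure_induction'' with
  | zero =>
    exact ⟨1, one_mem _, isUnit_one, by rw [connectiveChar_zero, mul_zero]; exact zero_mem _⟩
  | mem _ hx =>
    obtain ⟨i, rfl⟩ := hx
    exact ⟨1, one_mem _, isUnit_one, by rw [one_mul]; exact hB i⟩
  | neg_mem _ hx =>
    obtain ⟨i, rfl⟩ := hx
    have h := connectiveChar_add c (B i) (-B i)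
    rw [add_neg_cancel, connectiveChar_zero] at h
    refine ⟨1 - algebraMap R _ c * connectiveChar c (B i),
      sub_mem (one_mem _) (mul_mem (T.algebraMap_mem c) (hB i)),
      IsUnit.of_mul_eq_one (1 - algebraMap R _ c * connectiveChar c (-B i)) ?_, ?_⟩
    · linear_combination (-algebraMap R (ConnectiveAlgebra c M) c) * h.symm
    · have : (1 - algebraMap R _ c * connectiveChar c (B i)) * connectiveChar c (-B i) =
          -connectiveChar c (B i) := by linear_combination h.symm
      rw [this]
      exact neg_mem (hB i)
  | add l m _ _ hl hm =>
    rw [connectiveChar_add]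
    have e : connectiveChar c l + connectiveChar c m -
        algebraMap R _ c * connectiveChar c l * connectiveChar c m = connectiveChar c l +
        connectiveChar c m + algebraMap R _ (-c) * (connectiveChar c l * connectiveChar c m) := by
      rw [map_neg]; ring
    rw [e]
    exact hadd _ _ (hadd _ _ hl hm) (hmul _ _ (hR _) (hmul _ _ hl hm))

lemma connectiveToFormal_injective : Function.Injective (connectiveToFormal c B) := by
  rw [injective_iff_map_eq_zero]
  intro z hz
  obtain ⟨e, -, he, hez⟩ := exists_unit_mul_mem_adjoin c B z
  rw [← he.mul_right_eq_zero]
  rw [Algebra.adjoin_range_eq_range_aeval] at hez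
  obtain ⟨p, hp⟩ := hez
  have h1 : (connectiveToFormal c B).comp (MvPolynomial.aeval fun i => connectiveChar c (B i)) =
      MvPolynomial.coeToMvPowerSeries.algHom R := by
    refine MvPolynomial.algHom_ext fun i => ?_
    simp [connectiveToFormal_char, formalChar_basis, MvPolynomial.coeToMvPowerSeries.algHom_apply]
  have h2 : (p : MvPowerSeries κ R) = 0 := by
    have := AlgHom.congr_fun h1 p
    rw [AlgHom.comp_apply] at this
    change connectiveToFormal c B (MvPolynomial.aeval _ p) = _ at this
    change MvPolynomial.aeval _ p = _ at hp
    rw [hp, map_mul, hz, mul_zero] at this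
    simpa [MvPolynomial.coeToMvPowerSeries.algHom_apply] using this.symm
  have h3 : p = 0 := MvPolynomial.coe_injective κ R (by rw [h2, MvPolynomial.coe_zero])
  rw [← hp, h3]
  exact map_zero _

end Connective

/-! ### Properties shared by both versions of the formal group algebra -/

section FormalGroupAlgebra

variable {R : Type u} [CommRing R] {ι M N : Type v} [AddCommGroup M] [AddCommGroup N]
  {P : RootPairing ι ℤ M N}

/-- The properties that the power series version and the polynomial version of the formal group
algebra have in common, and from which everything else is derived. -/
structure Coefficients.IsFormalGroupAlgebra (A : Coefficients.{u, v} P) : Prop where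
  isDomain : IsDomain A.carrier
  x_zero : A.x 0 = 0
  x_add : ∀ l m, ∃ g, A.x (l + m) = A.x l + A.x m + A.x l * A.x m * g
  x_ne_zero : ∀ l, l ≠ 0 → A.x l ≠ 0
  /-- Functoriality in the lattice; an endomorphism of the lattice that is the identity modulo `m`
  induces the identity modulo `x_m`. -/
  exists_map : ∀ u : M →ₗ[ℤ] M, ∃ ψ : A.carrier →+* A.carrier, (∀ l, ψ (A.x l) = A.x (u l)) ∧
    ∀ m, (∀ l, A.x m ∣ A.x (u l) - A.x l) → ∀ s, A.x m ∣ ψ s - s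
  dvd_smul_sub : ∀ (w : P.weylGroup) (m : M), (∀ l, A.x m ∣ A.x (w • l) - A.x l) →
    ∀ s, A.x m ∣ w • s - s

lemma Theory.isFormalGroupAlgebra [IsDomain R] [CharZero R] {κ : Type v} [Finite κ]
    (h : Theory R) (B : Module.Basis κ ℤ M) :
    (h.coefficients P B).IsFormalGroupAlgebra := by
  have hdom : IsDomain (MvPowerSeries κ R) := NoZeroDivisors.to_isDomain _
  cases h with
  | formal F hF =>
    exact
      { isDomain := hdom
        x_zero := formalChar_zero F B
        x_add := formalChar_add_eq F B
        x_ne_zero := fun l => formalChar_ne_zero F B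
        exists_map := fun u => ⟨(formalMap F B u).toRingHom, formalMap_formalChar F B u,
          fun m hm => dvd_formalMap_sub F B u hm⟩
        dvd_smul_sub := fun w m hm => dvd_formalMap_sub F B (weylMap P w) hm }
  | connective c =>
    exact
      { isDomain := (connectiveToFormal_injective c B).isDomain (connectiveToFormal c B).toRingHom
        x_zero := connectiveChar_zero c
        x_add := fun l m => ⟨-algebraMap R (ConnectiveAlgebra c M) c, by
          refine (connectiveChar_add c l m).trans ?_
          change _ = connectiveChar c l + connectiveChar c m +
            connectiveChar c l * connectiveChar c m * _
          ring⟩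
        x_ne_zero := fun l hl h => formalChar_ne_zero (connectiveGroup c) B hl (by
          rw [← connectiveToFormal_char]
          exact (congrArg (connectiveToFormal c B) h).trans (map_zero _))
        exists_map := fun u => ⟨(connectiveMap c u).toRingHom, connectiveMap_char c u,
          fun m hm => dvd_connectiveMap_sub c u hm⟩
        dvd_smul_sub := fun w m hm => dvd_connectiveMap_sub c (weylMap P w) hm }

end FormalGroupAlgebra

/-! ### Coprimality of the elements attached to roots -/

section Coprime

variable {ι M N : Type v} [AddCommGroup M] [AddCommGroup N] {P : RootPairing ι ℤ M N}

lemma weylGroup_ofIdx_smul (i : ι) (m : M) : RootPairing.weylGroup.ofIdx P i • m =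
    m - P.toLinearMap m (P.coroot i) • P.root i :=
  P.reflection_apply i m

/-- A root that is not divisible by `2` in the character lattice takes the value `1` on some
cocharacter: its value on its own coroot is `2`. -/
lemma exists_toLinearMap_root_eq_one {i : ι} (h : ¬ ∃ μ : M, P.root i = (2 : ℤ) • μ) :
    ∃ n : N, P.toLinearMap (P.root i) n = 1 := by
  by_cases heven : ∀ n, 2 ∣ P.toLinearMap (P.root i) n
  · refine absurd ?_ h
    choose q hq using heven
    let f : N →ₗ[ℤ] ℤ :=
      { toFun := q
        map_add' := fun m n => by
          have := hq (m + n)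
          rw [map_add, hq m, hq n] at this
          omega
        map_smul' := fun k n => by
          have := hq (k • n)
          rw [map_smul, hq n, smul_eq_mul] at this
          rw [RingHom.id_apply, smul_eq_mul]
          linarith }
    obtain ⟨μ, hμ⟩ := P.isPerfPair_toLinearMap.bijective_left.2 f
    refine ⟨μ, P.isPerfPair_toLinearMap.bijective_left.1 (LinearMap.ext fun n => ?_)⟩
    rw [map_smul, hμ, hq n]
    rfl
  · push Not at heven
    obtain ⟨n, hn⟩ := heven
    refine ⟨n - (P.toLinearMap (P.root i) n / 2) • P.coroot i, ?_⟩
    rw [map_sub, map_smul, RootPairing.root_coroot_two, smul_eq_mul]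
    omega

variable {A : Coefficients.{u, v} P} (hA : A.IsFormalGroupAlgebra)

namespace Coefficients.IsFormalGroupAlgebra

include hA

lemma x_dvd_x_neg (m : M) : A.x m ∣ A.x (-m) := by
  obtain ⟨g, hg⟩ := hA.x_add m (-m)
  rw [add_neg_cancel, hA.x_zero] at hg
  exact ⟨-(1 + A.x (-m) * g), by linear_combination -hg⟩

lemma x_dvd_x_zsmul (m : M) (k : ℤ) : A.x m ∣ A.x (k • m) := by
  have hnat : ∀ (m : M) (n : ℕ), A.x m ∣ A.x (n • m) := by
    intro m n
    induction n with
    | zero => rw [zero_smul, hA.x_zero]; exact dvd_zero _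
    | succ n ih =>
      obtain ⟨g, hg⟩ := hA.x_add (n • m) m
      rw [succ_nsmul, hg]
      exact dvd_add (dvd_add ih dvd_rfl) ((ih.mul_right _).mul_right _)
  obtain ⟨n, rfl | rfl⟩ := k.eq_nat_or_neg
  · rw [natCast_zsmul]
    exact hnat m n
  · rw [neg_smul, natCast_zsmul, ← smul_neg]
    exact (hA.x_dvd_x_neg m).trans (hnat _ n)

lemma x_dvd_x_add_zsmul_sub (m l : M) (k : ℤ) : A.x m ∣ A.x (l + k • m) - A.x l := by
  obtain ⟨g, hg⟩ := hA.x_add l (k • m)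
  have : A.x (l + k • m) - A.x l = A.x (k • m) * (1 + A.x l * g) := by rw [hg]; ring
  rw [this]
  exact (hA.x_dvd_x_zsmul m k).mul_right _

/-- The element `1 / x_m + 1 / x_{-m}` has no denominator. -/
lemma exists_x_add_x_neg (m : M) : ∃ g, A.x m + A.x (-m) = A.x m * A.x (-m) * g := by
  obtain ⟨g, hg⟩ := hA.x_add m (-m)
  rw [add_neg_cancel, hA.x_zero] at hg
  exact ⟨-g, by linear_combination -hg⟩

/-- The divided difference operators preserve `S`. -/
lemma x_root_dvd_sub_smul (i : ι) (s : A.carrier) :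
    A.x (P.root i) ∣ s - RootPairing.weylGroup.ofIdx P i • s := by
  rw [dvd_sub_comm]
  refine hA.dvd_smul_sub _ _ (fun l => ?_) s
  rw [weylGroup_ofIdx_smul, sub_eq_add_neg l, ← neg_smul]
  exact hA.x_dvd_x_add_zsmul_sub _ _ _

lemma x_root_ne_zero (i : ι) : A.x (P.root i) ≠ 0 :=
  hA.x_ne_zero _ (P.ne_zero i)

/-- If `α` takes the value `1` on a cocharacter, then `ℤ α` has a complement in the character
lattice. The corresponding projection induces a retraction of `S` with kernel `x_α S`, so that
`x_α` is prime to `x_β` as soon as `β` is not a multiple of `α`. -/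
lemma x_root_dvd_of_dvd_mul_of_eq_one [P.IsReduced] {i j : ι} (h : P.root i ≠ P.root j)
    (h' : P.root i ≠ -P.root j) {n : N} (hn : P.toLinearMap (P.root i) n = 1) {s : A.carrier}
    (hs : A.x (P.root i) ∣ A.x (P.root j) * s) : A.x (P.root i) ∣ s := by
  have := hA.isDomain
  let p : M →ₗ[ℤ] M := LinearMap.id - (P.toLinearMap.flip n).smulRight (P.root i)
  have hp : ∀ l, p l = l - P.toLinearMap l n • P.root i := fun l => rfl
  obtain ⟨ψ, hψ, hψd⟩ := hA.exists_map p
  have hd : ∀ s, A.x (P.root i) ∣ ψ s - s := by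
    refine hψd _ fun l => ?_
    rw [hp, sub_eq_add_neg l, ← neg_smul]
    exact hA.x_dvd_x_add_zsmul_sub _ _ _
  have hj : A.x (p (P.root j)) ≠ 0 := by
    refine hA.x_ne_zero _ fun h0 => ?_
    have hli := RootPairing.IsReduced.linearIndependent P
      (fun e => h (congrArg P.root e)) h'
    rw [LinearIndependent.pair_iff] at hli
    have := hli (-P.toLinearMap (P.root j) n) 1 (by
      rw [hp] at h0
      rw [one_smul, neg_smul, neg_add_eq_sub, h0])
    exact one_ne_zero this.2
  have hψs : ψ s = 0 := by
    obtain ⟨a, ha⟩ := hs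
    have := congrArg ψ ha
    rw [map_mul, map_mul, hψ, hψ, hp (P.root i), hn, one_smul, sub_self, hA.x_zero, zero_mul] at this
    exact (mul_eq_zero.1 this).resolve_left hj
  have := hd s
  rwa [hψs, zero_sub, dvd_neg] at this

lemma x_root_dvd_of_dvd_mul [P.IsReduced] {i j : ι}
    (hcop : (∃ μ : M, P.root i = (2 : ℤ) • μ) → (∃ μ : M, P.root j = (2 : ℤ) • μ) →
      ∀ s : A.carrier, A.x (P.root i) ∣ A.x (P.root j) * s → A.x (P.root i) ∣ s)
    (h : P.root i ≠ P.root j) (h' : P.root i ≠ -P.root j) {s : A.carrier}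
    (hs : A.x (P.root i) ∣ A.x (P.root j) * s) : A.x (P.root i) ∣ s := by
  have := hA.isDomain
  by_cases hi : ∃ μ : M, P.root i = (2 : ℤ) • μ
  · by_cases hj : ∃ μ : M, P.root j = (2 : ℤ) • μ
    · exact hcop hi hj s hs
    · obtain ⟨n, hn⟩ := exists_toLinearMap_root_eq_one hj
      obtain ⟨a, ha⟩ := hs
      obtain ⟨a', rfl⟩ := hA.x_root_dvd_of_dvd_mul_of_eq_one h.symm
        (fun e => h' (by rw [e, neg_neg])) hn ⟨s, ha.symm⟩
      refine ⟨a', mul_left_cancel₀ (hA.x_root_ne_zero j) ?_⟩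
      rw [ha]
      ring
  · obtain ⟨n, hn⟩ := exists_toLinearMap_root_eq_one hi
    exact hA.x_root_dvd_of_dvd_mul_of_eq_one h h' hn hs

end Coefficients.IsFormalGroupAlgebra

end Coprime

/-! ### The highest root -/

section HighestRoot

variable {ι M N : Type v} [AddCommGroup M] [AddCommGroup N] {P : RootPairing ι ℤ M N}

/-- The cone of nonnegative combinations of simple roots is pointed. -/
lemma eq_zero_of_mem_of_neg_mem_closure (b : P.Base) {m : M}
    (h : m ∈ AddSubmonoid.closure (P.root '' b.support))
    (h' : -m ∈ AddSubmonoid.closure (P.root '' b.support)) : m = 0 := by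
  classical
  have hrep : ∀ m ∈ AddSubmonoid.closure (P.root '' b.support),
      ∃ f : ι → ℕ, m = ∑ j ∈ b.support, f j • P.root j := by
    intro m hm
    induction hm using AddSubmonoid.closure_induction with
    | mem _ hx =>
      obtain ⟨i, hi, rfl⟩ := hx
      refine ⟨Pi.single i 1, ?_⟩
      rw [Finset.sum_eq_single i]
      · simp
      · intro j _ hj
        simp [Pi.single_eq_of_ne hj]
      · intro h
        exact absurd hi h
    | zero => exact ⟨0, by simp⟩
    | add _ _ _ _ hx hy =>
      obtain ⟨f, rfl⟩ := hx
      obtain ⟨g, rfl⟩ := hy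
      exact ⟨f + g, by simp [add_smul, Finset.sum_add_distrib]⟩
  obtain ⟨f, hf⟩ := hrep _ h
  obtain ⟨g, hg⟩ := hrep _ h'
  have h0 : ∑ j ∈ b.support, ((f j : ℤ) + g j) • P.root j = 0 := by
    simp only [add_smul, Finset.sum_add_distrib, natCast_zsmul]
    rw [← hf, ← hg, add_neg_cancel]
  have hli := linearIndepOn_finset_iff.1 b.linearIndepOn_root _ h0
  rw [hf]
  refine Finset.sum_eq_zero fun j hj => ?_
  have := hli j hj
  have : f j = 0 := by omega
  rw [this, zero_smul]

/-- The highest root is long: no other root takes a value `≥ 2` on its coroot. -/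
lemma IsHighestRoot.root_eq_of_two_le {b : P.Base} {θ : ι} (hθ : IsHighestRoot b θ) {i : ι}
    (h : 2 ≤ P.pairing i θ) : P.root i = P.root θ := by
  set k := P.pairing i θ with hk
  have e1 : P.root θ - P.root (P.reflectionPerm θ i) = (1 + k) • P.root θ - P.root i := by
    rw [P.root_reflectionPerm, P.reflection_apply_root, ← hk]
    module
  have hneg : ∀ j, P.root (P.reflectionPerm j j) = -P.root j := fun j => by
    rw [P.root_reflectionPerm, P.reflection_apply_self]
  have hy : P.root i - (k - 1) • P.root θ ∈ AddSubmonoid.closure (P.root '' b.support) := by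
    have := hθ (P.reflectionPerm (P.reflectionPerm θ i) (P.reflectionPerm θ i))
    rw [hneg, P.root_reflectionPerm, P.reflection_apply_root, ← hk] at this
    convert this using 1
    module
  have hz := hθ i
  have h2θ : P.root θ + P.root θ ∈ AddSubmonoid.closure (P.root '' b.support) := by
    have := hθ (P.reflectionPerm θ θ)
    rwa [hneg, sub_neg_eq_add] at this
  obtain ⟨n, hn⟩ := Int.eq_ofNat_of_zero_le (show 0 ≤ k - 2 by omega)
  have h0 : n • (P.root θ + P.root θ) = 0 := by
    refine eq_zero_of_mem_of_neg_mem_closure b (nsmul_mem h2θ n) ?_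
    convert add_mem (add_mem hy hz) (add_mem hy hz) using 1
    rw [← natCast_zsmul]
    have : (n : ℤ) = k - 2 := hn.symm
    rw [this]
    module
  have hk2 : k = 2 := by
    have := congrArg (fun m => P.toLinearMap m (P.coroot θ)) h0
    simp only [map_nsmul, map_add, LinearMap.smul_apply, LinearMap.add_apply,
      RootPairing.root_coroot_two, map_zero, LinearMap.zero_apply, nsmul_eq_mul] at this
    omega
  rw [hk2] at hy
  refine (sub_eq_zero.1 (eq_zero_of_mem_of_neg_mem_closure b hz ?_)).symm
  convert hy using 1
  module

end HighestRoot

/-! ### The affine Weyl group -/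

section AffineWeylGroup

variable {ι M N : Type v} [AddCommGroup M] [AddCommGroup N] (P : RootPairing ι ℤ M N)

/-- The translation by an element of `N`. -/
def translate (n : N) : AffineWeylGroup P := SemidirectProduct.inl (Multiplicative.ofAdd n)

/-- The action of the Weyl group on the cocharacter lattice, as an additive automorphism. The inverse
makes it contragredient to the action on characters, as in `weylCoaction`. -/
def weylCoMap (w : P.weylGroup) : N ≃+ N :=
  (RootPairing.Equiv.coweightEquiv P P (w⁻¹ : P.weylGroup).1).toAddEquiv

lemma translate_add (m n : N) : translate P (m + n) = translate P m * translate P n :=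
  map_mul (SemidirectProduct.inl : _ →* AffineWeylGroup P) _ _

lemma translate_zero : translate P 0 = 1 := map_one SemidirectProduct.inl

lemma translate_neg (n : N) : translate P (-n) = (translate P n)⁻¹ :=
  map_inv (SemidirectProduct.inl : _ →* AffineWeylGroup P) _

lemma translation_eq (i : ι) : translation P i = translate P (P.coroot i) := rfl

lemma translate_zsmul (k : ℤ) (n : N) : translate P (k • n) = translate P n ^ k :=
  map_zpow (SemidirectProduct.inl : _ →* AffineWeylGroup P) (Multiplicative.ofAdd n) k

lemma inr_mul_translate (w : P.weylGroup) (n : N) :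
    (SemidirectProduct.inr w : AffineWeylGroup P) * translate P n =
      translate P (weylCoMap P w n) * SemidirectProduct.inr w := by
  have h : translate P (weylCoMap P w n) = SemidirectProduct.inl
    (weylCoaction P w (Multiplicative.ofAdd n)) := rfl
  rw [h, SemidirectProduct.inl_aut, map_inv, inv_mul_cancel_right]
  rfl

lemma eq_translate_mul_inr (w : AffineWeylGroup P) :
    ∃ n, w = translate P n * SemidirectProduct.inr w.right :=
  ⟨Multiplicative.toAdd w.left, (SemidirectProduct.inl_left_mul_inr_right w).symm⟩

lemma weylGroup_smul_weylCoMap (w : P.weylGroup) (l : M) (n : N) :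
    P.toLinearMap (w • l) (weylCoMap P w n) = P.toLinearMap l n := by
  have h : P.toLinearMap (w⁻¹ • w • l) n = P.toLinearMap (w • l) (weylCoMap P w n) :=
    LinearMap.congr_fun (RootPairing.Hom.weight_coweight_transpose_apply P P n
      (w⁻¹ : P.weylGroup).1.toHom) (w • l)
  rw [← h, inv_smul_smul]

lemma weylCoMap_coroot (w : P.weylGroup) (i : ι) :
    weylCoMap P w (P.coroot i) = P.coroot (P.weylGroupToPerm w i) :=
  RootPairing.Hom.coroot_coweightMap_apply P P i (w⁻¹ : P.weylGroup).1.toHom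

lemma ofIdx_inv (i : ι) :
    (RootPairing.weylGroup.ofIdx P i)⁻¹ = RootPairing.weylGroup.ofIdx P i :=
  Subtype.ext (RootPairing.Equiv.reflection_inv P i)

lemma ofIdx_mul_self (i : ι) :
    RootPairing.weylGroup.ofIdx P i * RootPairing.weylGroup.ofIdx P i = 1 := by
  rw [mul_eq_one_iff_eq_inv, ofIdx_inv]

lemma weylCoMap_ofIdx (i : ι) (n : N) :
    weylCoMap P (RootPairing.weylGroup.ofIdx P i) n =
      n - P.toLinearMap (P.root i) n • P.coroot i := by
  rw [weylCoMap, ofIdx_inv]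
  exact P.coreflection_apply i n

lemma weylGroup_ext {w w' : P.weylGroup} (h : ∀ l : M, w • l = w' • l) : w = w' :=
  Subtype.ext (RootPairing.Equiv.weightHom_injective P (LinearEquiv.ext h))

lemma mul_ofIdx_mul_inv (w : P.weylGroup) (i : ι) :
    w * RootPairing.weylGroup.ofIdx P i * w⁻¹ =
      RootPairing.weylGroup.ofIdx P (P.weylGroupToPerm w i) := by
  refine weylGroup_ext P fun l => ?_
  have h : P.toLinearMap (w⁻¹ • l) (P.coroot i) =
      P.toLinearMap l (P.coroot (P.weylGroupToPerm w i)) := by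
    rw [← weylGroup_smul_weylCoMap P w, smul_inv_smul, weylCoMap_coroot]
  rw [mul_smul, mul_smul, weylGroup_ofIdx_smul, weylGroup_ofIdx_smul, smul_sub, smul_inv_smul, h,
    ← RootPairing.weylGroup_apply_root, smul_comm]

lemma weylGroupToPerm_ofIdx (i j : ι) :
    P.weylGroupToPerm (RootPairing.weylGroup.ofIdx P i) j = P.reflectionPerm i j := rfl

lemma ofIdx_reflectionPerm_self (i : ι) :
    RootPairing.weylGroup.ofIdx P (P.reflectionPerm i i) = RootPairing.weylGroup.ofIdx P i := by
  rw [← weylGroupToPerm_ofIdx, ← mul_ofIdx_mul_inv, mul_inv_cancel_right]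

lemma inr_mul_rootReflection_mul_inv (w : P.weylGroup) (i : ι) :
    SemidirectProduct.inr w * rootReflection P i * (SemidirectProduct.inr w)⁻¹ =
      rootReflection P (P.weylGroupToPerm w i) := by
  rw [rootReflection, rootReflection, ← mul_ofIdx_mul_inv, map_mul, map_mul, map_inv]

lemma inr_mul_translation_mul_inv (w : P.weylGroup) (i : ι) :
    SemidirectProduct.inr w * translation P i * (SemidirectProduct.inr w)⁻¹ =
      translation P (P.weylGroupToPerm w i) := by
  rw [translation_eq, translation_eq, inr_mul_translate, mul_inv_cancel_right, weylCoMap_coroot]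

lemma rootReflection_mul_self (i : ι) : rootReflection P i * rootReflection P i = 1 := by
  rw [rootReflection, ← map_mul, ofIdx_mul_self, map_one]

lemma rootReflection_inv (i : ι) : (rootReflection P i)⁻¹ = rootReflection P i :=
  inv_eq_of_mul_eq_one_left (rootReflection_mul_self P i)

lemma rootReflection_mul_translate (i : ι) (n : N) :
    rootReflection P i * translate P n =
      translate P (n - P.toLinearMap (P.root i) n • P.coroot i) * rootReflection P i := by
  rw [rootReflection, inr_mul_translate, weylCoMap_ofIdx]

lemma translation_reflectionPerm_self (i : ι) :
    translation P (P.reflectionPerm i i) = (translation P i)⁻¹ := by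
  rw [translation_eq, translation_eq, P.coroot_reflectionPerm, P.coreflection_apply_self,
    translate_neg]

variable {P}

/-- In an indecomposable root datum, every root is conjugate to the highest root `θ` or to a root
whose value on the coroot of `θ` is `1`. -/
lemma IsHighestRoot.exists_weylGroup (hP : Indecomposable P) {b : P.Base} {θ : ι}
    (hθ : IsHighestRoot b θ) (i : ι) :
    ∃ w : P.weylGroup, P.weylGroupToPerm w i = θ ∨
      P.pairing (P.weylGroupToPerm w i) θ = 1 := by
  have hT := hP {j | ∃ w : P.weylGroup, P.toLinearMap (w • P.root i) (P.coroot j) ≠ 0}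
    ⟨i, 1, by rw [one_smul, P.root_coroot_two]; decide⟩ (by
      rintro k ⟨w, hw⟩ j hj
      simp only [Set.mem_ofPred_eq, not_exists, not_not] at hj
      have := hj (RootPairing.weylGroup.ofIdx P k * w)
      rw [mul_smul, weylGroup_ofIdx_smul, map_sub, LinearMap.sub_apply, hj w, LinearMap.map_smul,
        LinearMap.smul_apply, zero_sub, neg_eq_zero, smul_eq_mul] at this
      exact (mul_eq_zero.1 this).resolve_left hw)
  have hmain : ∀ j, 0 < P.pairing j θ → j = θ ∨ P.pairing j θ = 1 := by
    intro j hj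
    rcases (show P.pairing j θ = 1 ∨ 2 ≤ P.pairing j θ by omega) with h | h
    · exact Or.inr h
    · exact Or.inl (P.root.injective (hθ.root_eq_of_two_le h))
  obtain ⟨w, hw⟩ : θ ∈ {j | ∃ w : P.weylGroup, P.toLinearMap (w • P.root i) (P.coroot j) ≠ 0} :=
    hT ▸ Set.mem_univ θ
  rw [RootPairing.weylGroup_apply_root, P.root_coroot_eq_pairing] at hw
  rcases lt_or_gt_of_ne hw with h | h
  · refine ⟨RootPairing.weylGroup.ofIdx P (P.weylGroupToPerm w i) * w, hmain _ ?_⟩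
    rw [map_mul, Equiv.Perm.mul_apply, weylGroupToPerm_ofIdx, P.pairing_reflectionPerm_self_left]
    omega
  · exact ⟨w, hmain _ h⟩

lemma rootReflection_mem_closure [Finite ι] [P.IsReduced] (b : P.Base) (i : ι) :
    rootReflection P i ∈ Subgroup.closure (rootReflection P '' b.support) := by
  refine b.induction_reflect i (fun i hi => ?_)
    (fun i hi => Subgroup.subset_closure (Set.mem_image_of_mem _ hi))
    (fun i j hi hj => ?_)
  · rwa [rootReflection, ofIdx_reflectionPerm_self]
  · rw [← weylGroupToPerm_ofIdx, ← inr_mul_rootReflection_mul_inv]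
    have hj' : rootReflection P j ∈ Subgroup.closure (rootReflection P '' b.support) :=
      Subgroup.subset_closure (Set.mem_image_of_mem _ hj)
    exact mul_mem (mul_mem hj' hi) (inv_mem hj')

lemma inr_mem_of_rootReflection_mem {H : Subgroup (AffineWeylGroup P)}
    (h : ∀ i, rootReflection P i ∈ H) (w : P.weylGroup) :
    (SemidirectProduct.inr w : AffineWeylGroup P) ∈ H := by
  have hw : w ∈ Subgroup.closure (Set.range (RootPairing.weylGroup.ofIdx P)) := by
    obtain ⟨w, hw⟩ := w
    induction hw using RootPairing.weylGroup.induction with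
    | mem i => exact Subgroup.subset_closure ⟨i, rfl⟩
    | one => exact one_mem _
    | mul x y hx hy hx' hy' => exact mul_mem hx' hy'
  induction hw using Subgroup.closure_induction with
  | mem _ hx =>
    obtain ⟨i, rfl⟩ := hx
    exact h i
  | one => rw [map_one]; exact one_mem _
  | mul x y _ _ hx hy => rw [map_mul]; exact mul_mem hx hy
  | inv x _ hx => rw [map_inv]; exact inv_mem hx

/-- The affine Weyl group is generated by the simple reflections and by `s_0`. The translations by
the conjugates of `θ^∨` generate all others, because every coroot that is not such a conjugate is
the difference of two of them. -/
lemma closure_simple_affine_reflections [Finite ι] [P.IsReduced] (hP : Indecomposable P)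
    (hsc : Submodule.span ℤ (Set.range P.coroot) = ⊤) {b : P.Base} {θ : ι}
    (hθ : IsHighestRoot b θ) :
    Subgroup.closure (rootReflection P '' b.support ∪ {affineRefl P θ}) = ⊤ := by
  set H := Subgroup.closure (rootReflection P '' b.support ∪ {affineRefl P θ})
  have hrefl : ∀ i, rootReflection P i ∈ H := fun i =>
    Subgroup.closure_mono Set.subset_union_left (rootReflection_mem_closure b i)
  have hinr := inr_mem_of_rootReflection_mem hrefl
  have hconj : ∀ (w : P.weylGroup) (i : ι), translation P (P.weylGroupToPerm w i) ∈ H →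
      translation P i ∈ H := by
    intro w i h
    rw [← inr_mul_translation_mul_inv] at h
    have := mul_mem (mul_mem (inv_mem (hinr w)) h) (hinr w)
    simpa [mul_assoc] using this
  have hθH : translation P θ ∈ H := by
    have h0 : affineRefl P θ ∈ H := Subgroup.subset_closure (Or.inr rfl)
    have := mul_mem h0 (hrefl θ)
    rwa [affineRefl, mul_assoc, rootReflection_mul_self, mul_one] at this
  have htrans : ∀ i, translation P i ∈ H := by
    intro i
    obtain ⟨w, hw⟩ := hθ.exists_weylGroup hP i
    refine hconj w i ?_
    rcases hw with hw | hw
    · rw [hw]; exact hθH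
    · set j := P.weylGroupToPerm w i
      have h1 := mul_mem (mul_mem (hrefl j) hθH) (hrefl j)
      rw [translation_eq, rootReflection_mul_translate, mul_assoc, rootReflection_mul_self,
        mul_one, P.root_coroot_eq_pairing, hw, one_smul] at h1
      have h2 := mul_mem (inv_mem h1) hθH
      rw [translation_eq, ← translate_neg, ← translate_add, neg_sub, sub_add_cancel] at h2
      exact h2
  have hN : ∀ n, translate P n ∈ H := by
    intro n
    have hn : n ∈ Submodule.span ℤ (Set.range P.coroot) := hsc ▸ Submodule.mem_top
    induction hn using Submodule.span_induction with
    | mem _ hx =>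
      obtain ⟨i, rfl⟩ := hx
      exact htrans i
    | zero => rw [translate_zero]; exact one_mem _
    | add x y _ _ hx hy => rw [translate_add]; exact mul_mem hx hy
    | smul k x _ hx => rw [translate_zsmul]; exact zpow_mem hx k
  refine (Subgroup.eq_top_iff' H).2 fun w => ?_
  obtain ⟨n, hn⟩ := eq_translate_mul_inr P w
  rw [hn]
  exact mul_mem (hN n) (hinr _)

end AffineWeylGroup

/-! ### Identities for a root subsystem of rank one -/

section RankOne

variable {K : Type*} [Ring K] {p m v t t' s X Z : K}

/-- The relation between `Z = (1 / x_α) (1 - η_t)` and `X = (1 / x_α) (1 - η_s)`, where `t` is the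
translation by `α^∨` and `s` the reflection in `α`. Here `p` and `m = v p` stand for `1 / x_α` and
`1 / x_{-α}`, and `t'` for the inverse of `t`. -/
lemma rankOne_mul_translation (hZ : Z = p * (1 - t)) (hX : X = p * (1 - s)) (hsp : s * p = m * s)
    (hst : s * t = t' * s) (htt' : t * t' = 1) (ht't : t' * t = 1) (htp : t * p = p * t)
    (htm : t * m = m * t) (ht'p : t' * p = p * t') (hv : v * p = m) (z : K) :
    X * (Z * z) = Z * ((p + m) * z + v * t' * (Z * z) - v * t' * (X * z)) := by
  have e1 : v * t' * Z = m * t' - m := by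
    rw [hZ, mul_assoc, ← mul_assoc t', ht'p, mul_assoc, ← mul_assoc v, hv, mul_sub, mul_one, ht't,
      mul_sub, mul_one]
  have e2 : v * t' * X = m * t' - m * t' * s := by
    rw [hX, mul_assoc, ← mul_assoc t', ht'p, mul_assoc, ← mul_assoc v, hv, mul_sub, mul_one,
      mul_sub, mul_assoc]
  have e3 : (1 - t) * (m * t' * s) = m * t' * s - m * s := by
    rw [sub_mul, one_mul, ← mul_assoc, ← mul_assoc, htm, mul_assoc m t t', htt', mul_one]
  have e4 : (1 - t) * p = p * (1 - t) := by rw [sub_mul, one_mul, mul_sub, mul_one, htp]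
  have e5 : (1 - s) * (p * (1 - t)) = p * (1 - t) - m * s + m * t' * s := by
    rw [← mul_assoc, sub_mul, one_mul, hsp, sub_mul, mul_assoc m, mul_sub s, mul_one, hst]
    noncomm_ring
  have e6 : p + m + (m * t' - m) - (m * t' - m * t' * s) = p + m * t' * s := by abel
  rw [← mul_assoc (v * t'), ← mul_assoc (v * t'), ← add_mul, ← sub_mul, ← mul_assoc, ← mul_assoc,
    e1, e2, e6, hX, hZ, mul_assoc p (1 - s), e5, mul_assoc p (1 - t), mul_add (1 - t), e3, e4]
  congr 2
  abel

lemma rankOne_mul_self (hX : X = p * (1 - s)) (hsp : s * p = m * s) (hss : s * s = 1)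
    (hmp : m * p = p * m) (z : K) : X * (X * z) = (p + m) * (X * z) := by
  have e : (1 - s) * (p * (1 - s)) = (p + m) * (1 - s) := by
    rw [← mul_assoc, sub_mul, one_mul, hsp, sub_mul, mul_assoc m, mul_sub s, mul_one, hss]
    noncomm_ring
  rw [← mul_assoc, ← mul_assoc, hX, mul_assoc p, e, ← mul_assoc, ← mul_assoc, mul_add,
    add_mul p m p, hmp]

lemma rankOne_translation_mul (hZ : Z = p * (1 - t)) (hX : X = p * (1 - s))
    (hst' : s * t' = t * s) (htt' : t * t' = 1) (htp : t * p = p * t) (z : K) :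
    t * (X * z) = X * (t' * z) - Z * (z + t' * z) := by
  have e : p * (1 - t) * (1 + t') = p * (t' - t) := by
    rw [mul_assoc, sub_mul, one_mul, mul_add, htt']
    noncomm_ring
  have e' : t * X = X * t' - Z * (1 + t') := by
    rw [hX, hZ, e, ← mul_assoc, htp, mul_assoc, mul_assoc, sub_mul, one_mul, hst']
    noncomm_ring
  rw [← mul_assoc, e', sub_mul, mul_assoc, mul_assoc, add_mul, one_mul]

lemma rankOne_translation_inv_mul (hZ : Z = p * (1 - t)) (hX : X = p * (1 - s))
    (hst : s * t = t' * s) (htt' : t * t' = 1) (ht'p : t' * p = p * t') (z : K) :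
    t' * (X * z) = X * (t * z) + Z * (z + t' * z) := by
  have e : p * (1 - t) * (1 + t') = p * (t' - t) := by
    rw [mul_assoc, sub_mul, one_mul, mul_add, htt']
    noncomm_ring
  have e' : t' * X = X * t + Z * (1 + t') := by
    rw [hX, hZ, e, ← mul_assoc, ht'p, mul_assoc, mul_assoc, sub_mul, one_mul, hst]
    noncomm_ring
  rw [← mul_assoc, e', add_mul, mul_assoc, mul_assoc, add_mul, one_mul]

lemma commute_rankOne {y : K} (hp : y * p = p * y) (ht : y * t = t * y) :
    Commute y (p * (1 - t)) :=
  (Commute.mul_right hp ((Commute.one_right y).sub_right ht))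

/-- The twisted Leibniz rule. Here `c'` stands for the image of `c` under the reflection `s`. -/
lemma rankOne_mul_scalar {c c' : K} (hX : X = p * (1 - s)) (hsc : s * c = c' * s)
    (hpc : p * c' = c' * p) (z : K) : X * (c * z) = c' * (X * z) + p * (c - c') * z := by
  have e : (1 - s) * c = c' * (1 - s) + (c - c') := by
    rw [sub_mul, one_mul, hsc]
    noncomm_ring
  rw [← mul_assoc, hX, mul_assoc p, e, mul_add, ← mul_assoc p, hpc, add_mul, mul_assoc c',
    mul_assoc c']

lemma mul_one_sub_mul (p t u : K) (htp : t * p = p * t) :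
    p * (1 - t * u) = p * (1 - t) + t * (p * (1 - u)) := by
  rw [← mul_assoc, htp]
  noncomm_ring

end RankOne

/-! ### The twisted group algebra -/

section TwistedGroupAlgebra

variable {ι M N : Type v} [AddCommGroup M] [AddCommGroup N] {P : RootPairing ι ℤ M N}
  (A : Coefficients.{u, v} P)

/-- The embedding `q ↦ q η_1` of `Q` into the twisted group algebra. -/
def scalar : RootLocalization A →+* TwistedGroupAlgebra A := SkewMonoidAlgebra.singleOneRingHom

lemma eta_one : eta A 1 = 1 := rfl

lemma eta_mul (w w' : AffineWeylGroup P) : eta A (w * w') = eta A w * eta A w' := by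
  simp [eta]

lemma eta_mul_scalar (w : AffineWeylGroup P) (q : RootLocalization A) :
    eta A w * scalar A q = scalar A (w • q) * eta A w := by
  change SkewMonoidAlgebra.single w 1 * SkewMonoidAlgebra.single 1 q =
    SkewMonoidAlgebra.single 1 _ * SkewMonoidAlgebra.single w 1
  simp

lemma scalar_mul (q : RootLocalization A) (z : TwistedGroupAlgebra A) :
    scalar A q * z = q • z := by
  have h : scalar A q = q • (1 : TwistedGroupAlgebra A) := by
    change SkewMonoidAlgebra.single 1 q = q • SkewMonoidAlgebra.single 1 1
    rw [SkewMonoidAlgebra.smul_single, smul_eq_mul, mul_one]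
  rw [h, smul_mul_twisted, one_mul]

lemma scalar_algebraMap_mul (s : A.carrier) (z : TwistedGroupAlgebra A) :
    scalar A (algebraMap _ _ s) * z = s • z := by
  rw [scalar_mul, algebraMap_smul]

lemma twisted_induction {p : TwistedGroupAlgebra A → Prop} (z : TwistedGroupAlgebra A)
    (zero : p 0) (add : ∀ y z, p y → p z → p (y + z))
    (smul_eta : ∀ q w, p (scalar A q * eta A w)) : p z := by
  induction z using SkewMonoidAlgebra.induction_on with
  | zero => exact zero
  | single w q =>
    convert smul_eta q w using 1
    rw [scalar_mul, eta, SkewMonoidAlgebra.smul_single, smul_eq_mul, mul_one]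
  | add y z hy hz => exact add _ _ hy hz

lemma affine_smul_localization (w : AffineWeylGroup P) (q : RootLocalization A) :
    w • q = w.right • q := rfl

lemma smul_algebraMap_localization (w : P.weylGroup) (s : A.carrier) :
    w • algebraMap A.carrier (RootLocalization A) s = algebraMap _ _ (w • s) :=
  localizationMap_algebraMap A w s

variable {A}

lemma invX_mul_x (i : ι) : invX A i * algebraMap _ _ (A.x (P.root i)) = 1 := by
  rw [invX, ← Localization.mk_one_eq_algebraMap, Localization.mk_mul, one_mul, mul_one]
  exact Localization.mk_self (⟨A.x (P.root i), _⟩ : rootSubmonoid A)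

lemma isUnit_x (i : ι) : IsUnit (algebraMap A.carrier (RootLocalization A) (A.x (P.root i))) :=
  IsUnit.of_mul_eq_one _ ((mul_comm _ _).trans (invX_mul_x i))

lemma eq_invX_mul_of_mul_eq {i : ι} {q r : RootLocalization A}
    (h : algebraMap _ _ (A.x (P.root i)) * q = r) : q = invX A i * r := by
  rw [← h, ← mul_assoc, invX_mul_x, one_mul]

lemma smul_invX (w : P.weylGroup) (i : ι) : w • invX A i = invX A (P.weylGroupToPerm w i) := by
  have h := congrArg (w • ·) (invX_mul_x (A := A) i)
  simp only [smul_mul', smul_algebraMap_localization, A.smul_x, smul_one,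
    RootPairing.weylGroup_apply_root] at h
  rw [eq_invX_mul_of_mul_eq ((mul_comm _ _).trans h), mul_one]

lemma root_reflectionPerm_self (i : ι) : P.root (P.reflectionPerm i i) = -P.root i := by
  rw [P.root_reflectionPerm, P.reflection_apply_self]

lemma Coefficients.IsFormalGroupAlgebra.exists_invX_neg (hA : A.IsFormalGroupAlgebra) (i : ι) :
    ∃ v : A.carrier, algebraMap _ _ v * invX A i = invX A (P.reflectionPerm i i) := by
  obtain ⟨v, hv⟩ := hA.x_dvd_x_neg (-P.root i)
  rw [neg_neg] at hv
  refine ⟨v, ?_⟩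
  refine (eq_invX_mul_of_mul_eq (r := 1) ?_).trans (mul_one _)
  rw [root_reflectionPerm_self, ← mul_assoc, ← map_mul, ← hv, mul_comm, invX_mul_x]

lemma Coefficients.IsFormalGroupAlgebra.exists_invX_add_invX_neg (hA : A.IsFormalGroupAlgebra)
    (i : ι) : ∃ g : A.carrier, invX A i + invX A (P.reflectionPerm i i) = algebraMap _ _ g := by
  obtain ⟨g, hg⟩ := hA.exists_x_add_x_neg (P.root i)
  have h := congrArg (algebraMap A.carrier (RootLocalization A)) hg
  rw [← root_reflectionPerm_self] at h
  simp only [map_add, map_mul] at h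
  have h1 := invX_mul_x (A := A) i
  have h2 := invX_mul_x (A := A) (P.reflectionPerm i i)
  refine ⟨g, ?_⟩
  generalize invX A i = p at *
  generalize invX A (P.reflectionPerm i i) = m at *
  generalize algebraMap A.carrier (RootLocalization A) (A.x (P.root i)) = a at *
  generalize algebraMap A.carrier (RootLocalization A) (A.x (P.root (P.reflectionPerm i i))) = b
    at *
  generalize algebraMap A.carrier (RootLocalization A) g = g at *
  have e : p + m = p * m * (a + b) := by linear_combination (-m) * h1 - p * h2
  rw [e, h]
  linear_combination (g * m * b) * h1 + g * h2

variable (A)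

/-- The element `Z_α = (1 / x_α) (1 - η_{t_{α^∨}})`. -/
def translationElement (i : ι) : TwistedGroupAlgebra A :=
  scalar A (invX A i) * (1 - eta A (translation P i))

lemma demazureElement_eq (i : ι) :
    demazureElement A i = scalar A (invX A i) * (1 - eta A (rootReflection P i)) :=
  (scalar_mul A _ _).symm

lemma affineDemazureElement_eq (θ : ι) : affineDemazureElement A θ =
    scalar A (invX A (P.reflectionPerm θ θ)) * (1 - eta A (affineRefl P θ)) :=
  (scalar_mul A _ _).symm

lemma eta_mul_scalar_mul_one_sub (w v : AffineWeylGroup P) (i : ι) :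
    eta A w * (scalar A (invX A i) * (1 - eta A v)) =
      scalar A (invX A (P.weylGroupToPerm w.right i)) * (1 - eta A (w * v * w⁻¹)) * eta A w := by
  rw [← mul_assoc, eta_mul_scalar, affine_smul_localization, smul_invX, mul_assoc, mul_assoc,
    mul_sub, sub_mul, ← eta_mul, ← eta_mul, inv_mul_cancel_right, mul_one, one_mul]

/-- Translations commute with scalars. -/
lemma eta_translate_mul_scalar (n : N) (q : RootLocalization A) :
    eta A (translate P n) * scalar A q = scalar A q * eta A (translate P n) := by
  rw [eta_mul_scalar, affine_smul_localization]
  change scalar A ((1 : P.weylGroup) • q) * _ = _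
  rw [one_smul]

lemma eta_translation_mul_scalar (i : ι) (q : RootLocalization A) :
    eta A (translation P i) * scalar A q = scalar A q * eta A (translation P i) :=
  eta_translate_mul_scalar A _ q

lemma eta_translation_inv_mul_scalar (i : ι) (q : RootLocalization A) :
    eta A (translation P i)⁻¹ * scalar A q = scalar A q * eta A (translation P i)⁻¹ := by
  rw [translation_eq, ← translate_neg, eta_translate_mul_scalar]

lemma eta_mul_eta_inv (w : AffineWeylGroup P) : eta A w * eta A w⁻¹ = 1 := by
  rw [← eta_mul, mul_inv_cancel, eta_one]

lemma eta_inv_mul_eta (w : AffineWeylGroup P) : eta A w⁻¹ * eta A w = 1 := by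
  rw [← eta_mul, inv_mul_cancel, eta_one]

lemma eta_rootReflection_mul_scalar_invX (i : ι) :
    eta A (rootReflection P i) * scalar A (invX A i) =
      scalar A (invX A (P.reflectionPerm i i)) * eta A (rootReflection P i) := by
  rw [eta_mul_scalar]
  congr 2
  exact smul_invX _ _

lemma rootReflection_mul_translation (i : ι) :
    rootReflection P i * translation P i = (translation P i)⁻¹ * rootReflection P i := by
  rw [translation_eq, rootReflection_mul_translate, P.root_coroot_two, ← translate_neg]
  congr 2
  module

lemma rootReflection_mul_translation_inv (i : ι) :
    rootReflection P i * (translation P i)⁻¹ = translation P i * rootReflection P i := by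
  rw [mul_inv_eq_iff_eq_mul, mul_assoc, rootReflection_mul_translation, mul_inv_cancel_left]

lemma translationElement_pow (i : ι) (d : ℕ) : translationElement A i ^ d =
    scalar A (invX A i ^ d) * (1 - eta A (translation P i)) ^ d := by
  rw [translationElement, Commute.mul_pow, map_pow]
  rw [Commute, SemiconjBy, mul_sub, sub_mul, one_mul, mul_one, eta_translation_mul_scalar]

end TwistedGroupAlgebra

/-! ### Elements of the Demazure algebra -/

section DemazureAlgebra

variable {ι M N : Type v} [AddCommGroup M] [AddCommGroup N] {P : RootPairing ι ℤ M N}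
  {A : Coefficients.{u, v} P} {b : P.Base} {θ : ι}

lemma scalar_x_mul_scalar_invX_mul (i : ι) (z : TwistedGroupAlgebra A) :
    scalar A (algebraMap _ _ (A.x (P.root i))) * (scalar A (invX A i) * z) = z := by
  rw [← mul_assoc, ← map_mul, mul_comm (algebraMap _ _ _), invX_mul_x, map_one, one_mul]

lemma scalar_algebraMap_mem (s : A.carrier) :
    scalar A (algebraMap _ _ s) ∈ demazureAlgebra A b θ := by
  refine Subring.subset_closure (Or.inl (Or.inl ⟨s, ?_⟩))
  exact (scalar_algebraMap_mul A s 1).symm.trans (mul_one _)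

lemma eta_mem_of_demazure_mem {D : Subring (TwistedGroupAlgebra A)}
    (hs : ∀ s : A.carrier, scalar A (algebraMap _ _ s) ∈ D) {i : ι} {w : AffineWeylGroup P}
    (h : scalar A (invX A i) * (1 - eta A w) ∈ D) : eta A w ∈ D := by
  have h1 := sub_mem (one_mem D) (mul_mem (hs (A.x (P.root i))) h)
  rwa [scalar_x_mul_scalar_invX_mul, sub_sub_cancel] at h1

lemma reflectionPerm_reflectionPerm_self (i : ι) :
    P.reflectionPerm (P.reflectionPerm i i) (P.reflectionPerm i i) = i :=
  P.root.injective (by rw [root_reflectionPerm_self, root_reflectionPerm_self, neg_neg])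

lemma translate_mul_rootReflection_mul_inv (n : N) (i : ι) :
    translate P n * rootReflection P i * (translate P n)⁻¹ =
      translation P i ^ P.toLinearMap (P.root i) n * rootReflection P i := by
  rw [mul_assoc, ← translate_neg, rootReflection_mul_translate, ← mul_assoc, ← translate_add,
    translation_eq, ← translate_zsmul, map_neg]
  congr 2
  module

lemma affineRefl_inv (i : ι) : (affineRefl P i)⁻¹ = affineRefl P i := by
  rw [affineRefl, mul_inv_rev, rootReflection_inv, rootReflection_mul_translation_inv]

variable [Finite ι] [P.IsReduced] (hP : Indecomposable P)
  (hsc : Submodule.span ℤ (Set.range P.coroot) = ⊤) (hθ : IsHighestRoot b θ)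

include hP hsc hθ

/-- All `η_w` lie in `D_{W_a}`. -/
lemma eta_mem_demazureAlgebra (w : AffineWeylGroup P) : eta A w ∈ demazureAlgebra A b θ := by
  have hw : w ∈ Subgroup.closure (rootReflection P '' b.support ∪ {affineRefl P θ}) :=
    closure_simple_affine_reflections hP hsc hθ ▸ Subgroup.mem_top w
  have hgen : ∀ w ∈ rootReflection P '' b.support ∪ {affineRefl P θ},
      eta A w ∈ demazureAlgebra A b θ := by
    rintro _ (⟨i, hi, rfl⟩ | rfl)
    · refine eta_mem_of_demazure_mem scalar_algebraMap_mem (i := i) ?_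
      rw [← demazureElement_eq]
      exact Subring.subset_closure (Or.inl (Or.inr ⟨i, hi, rfl⟩))
    · refine eta_mem_of_demazure_mem scalar_algebraMap_mem (i := P.reflectionPerm θ θ) ?_
      rw [← affineDemazureElement_eq]
      exact Subring.subset_closure (Or.inr rfl)
  induction hw using Subgroup.closure_induction'' with
  | one => rw [eta_one]; exact one_mem _
  | mem w hw => exact hgen w hw
  | inv_mem w hw =>
    have : w⁻¹ = w := by
      rcases hw with ⟨i, _, rfl⟩ | rfl
      · exact rootReflection_inv P i
      · exact affineRefl_inv θ
    rw [this]
    exact hgen w hw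
  | mul w w' _ _ h h' => rw [eta_mul]; exact mul_mem h h'

lemma conj_mem_demazureAlgebra {i : ι} {v : AffineWeylGroup P}
    (h : scalar A (invX A i) * (1 - eta A v) ∈ demazureAlgebra A b θ) (w : AffineWeylGroup P) :
    scalar A (invX A (P.weylGroupToPerm w.right i)) * (1 - eta A (w * v * w⁻¹)) ∈
      demazureAlgebra A b θ := by
  have hη := eta_mem_demazureAlgebra (A := A) hP hsc hθ
  have h1 := mul_mem (mul_mem (hη w) h) (hη w⁻¹)
  rwa [eta_mul_scalar_mul_one_sub, mul_assoc, eta_mul_eta_inv, mul_one] at h1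

/-- The elements `X_α`, for all roots `α`, lie in `D_{W_a}`. -/
lemma demazureElement_mem (hA : A.IsFormalGroupAlgebra) (i : ι) :
    demazureElement A i ∈ demazureAlgebra A b θ := by
  refine b.induction_reflect i (p := fun i => demazureElement A i ∈ demazureAlgebra A b θ)
    (fun i hi => ?_)
    (fun i hi => Subring.subset_closure (Or.inl (Or.inr (Set.mem_image_of_mem _ hi))))
    (fun i j hi hj => ?_)
  · obtain ⟨v, hv⟩ := hA.exists_invX_neg i
    rw [demazureElement_eq] at hi ⊢
    rw [← hv, rootReflection, ofIdx_reflectionPerm_self, map_mul, mul_assoc]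
    exact mul_mem (scalar_algebraMap_mem v) hi
  · rw [demazureElement_eq] at hi ⊢
    have := conj_mem_demazureAlgebra hP hsc hθ hi (rootReflection P j)
    rw [rootReflection, inr_mul_rootReflection_mul_inv] at this
    exact this

/-- The elements `Z_α`, for all roots `α`, lie in `D_{W_a}`. If `α` is conjugate to `θ` this comes
from `X_0`; otherwise, `t_{α^∨} s_α` is conjugate to `s_α` by a translation. -/
lemma translationElement_mem (hA : A.IsFormalGroupAlgebra) (i : ι) :
    translationElement A i ∈ demazureAlgebra A b θ := by
  have hη := eta_mem_demazureAlgebra (A := A) hP hsc hθ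
  have hX := demazureElement_mem hP hsc hθ hA
  have key : ∀ j, scalar A (invX A j) * (1 - eta A (affineRefl P j)) ∈ demazureAlgebra A b θ →
      translationElement A j ∈ demazureAlgebra A b θ := by
    intro j hj
    have h1 := sub_mem hj (mul_mem (hη (translation P j)) (hX j))
    rwa [demazureElement_eq, affineRefl, eta_mul, mul_one_sub_mul _ _ _
      (eta_translation_mul_scalar A j _), add_sub_cancel_right] at h1
  obtain ⟨w, hw⟩ := hθ.exists_weylGroup hP i
  have hj : translationElement A (P.weylGroupToPerm w i) ∈ demazureAlgebra A b θ := by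
    refine key _ ?_
    rcases hw with hw | hw
    · rw [hw]
      obtain ⟨v, hv⟩ := hA.exists_invX_neg (P.reflectionPerm θ θ)
      rw [reflectionPerm_reflectionPerm_self] at hv
      have hX0 : affineDemazureElement A θ ∈ demazureAlgebra A b θ :=
        Subring.subset_closure (Or.inr rfl)
      rw [← hv, map_mul, mul_assoc, ← affineDemazureElement_eq]
      exact mul_mem (scalar_algebraMap_mem v) hX0
    · set j := P.weylGroupToPerm w i
      have h := hX j
      rw [demazureElement_eq] at h
      have := conj_mem_demazureAlgebra hP hsc hθ h (translate P (P.coroot θ))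
      rw [translate_mul_rootReflection_mul_inv, P.root_coroot_eq_pairing, hw, zpow_one] at this
      exact this
  have h := conj_mem_demazureAlgebra hP hsc hθ hj (SemidirectProduct.inr w⁻¹)
  have h2 := inr_mul_translation_mul_inv P w⁻¹ (P.weylGroupToPerm w i)
  rw [h2] at h
  simpa [translationElement] using h

end DemazureAlgebra

/-! ### Coefficients localized away from a root -/

section LocalCoefficients

variable {ι M N : Type v} [AddCommGroup M] [AddCommGroup N] {P : RootPairing ι ℤ M N}
  (A : Coefficients.{u, v} P) (i : ι)

/-- The subring `S_α = S[1 / x_β : β ≠ ±α]` of `Q`. -/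
def localCoefficients : Subring (RootLocalization A) :=
  Subring.closure (Set.range (algebraMap A.carrier (RootLocalization A)) ∪
    invX A '' {j | P.root i ≠ P.root j ∧ P.root i ≠ -P.root j})

variable {A i}

lemma algebraMap_mem_localCoefficients (s : A.carrier) :
    algebraMap _ _ s ∈ localCoefficients A i :=
  Subring.subset_closure (Or.inl ⟨s, rfl⟩)

lemma invX_mem_localCoefficients {j : ι} (h : P.root i ≠ P.root j) (h' : P.root i ≠ -P.root j) :
    invX A j ∈ localCoefficients A i :=
  Subring.subset_closure (Or.inr ⟨j, ⟨h, h'⟩, rfl⟩)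

lemma exists_mul_eq_of_mem_localCoefficients {q : RootLocalization A}
    (hq : q ∈ localCoefficients A i) :
    ∃ p ∈ Submonoid.closure
      ((fun j => A.x (P.root j)) '' {j | P.root i ≠ P.root j ∧ P.root i ≠ -P.root j}),
      ∃ s : A.carrier, algebraMap _ _ p * q = algebraMap _ _ s := by
  induction hq using Subring.closure_induction with
  | mem q hq =>
    rcases hq with ⟨s, rfl⟩ | ⟨j, hj, rfl⟩
    · exact ⟨1, one_mem _, s, by rw [map_one, one_mul]⟩
    · exact ⟨_, Submonoid.subset_closure ⟨j, hj, rfl⟩, 1, by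
        rw [map_one, mul_comm]; exact invX_mul_x j⟩
  | zero => exact ⟨1, one_mem _, 0, by rw [mul_zero, map_zero]⟩
  | one => exact ⟨1, one_mem _, 1, by rw [map_one, one_mul]⟩
  | add q r _ _ hq hr =>
    obtain ⟨p, hp, s, hs⟩ := hq
    obtain ⟨p', hp', s', hs'⟩ := hr
    refine ⟨p * p', mul_mem hp hp', p' * s + p * s', ?_⟩
    simp only [map_mul, map_add, ← hs, ← hs']
    ring
  | neg q _ hq =>
    obtain ⟨p, hp, s, hs⟩ := hq
    exact ⟨p, hp, -s, by rw [mul_neg, hs, map_neg]⟩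
  | mul q r _ _ hq hr =>
    obtain ⟨p, hp, s, hs⟩ := hq
    obtain ⟨p', hp', s', hs'⟩ := hr
    refine ⟨p * p', mul_mem hp hp', s * s', ?_⟩
    simp only [map_mul, ← hs, ← hs']
    ring

lemma ofIdx_smul_mem_localCoefficients {q : RootLocalization A}
    (hq : q ∈ localCoefficients A i) :
    RootPairing.weylGroup.ofIdx P i • q ∈ localCoefficients A i := by
  induction hq using Subring.closure_induction with
  | mem q hq =>
    rcases hq with ⟨s, rfl⟩ | ⟨j, ⟨hj, hj'⟩, rfl⟩
    · rw [smul_algebraMap_localization]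
      exact algebraMap_mem_localCoefficients _
    · rw [smul_invX, weylGroupToPerm_ofIdx]
      refine invX_mem_localCoefficients (fun h => hj' ?_) (fun h => hj ?_)
      · rw [P.root_reflectionPerm] at h
        have := congrArg (P.reflection i) h
        rw [P.reflection_same, P.reflection_apply_self] at this
        rw [← this, neg_neg]
      · rw [P.root_reflectionPerm] at h
        have := congrArg (P.reflection i) h
        rw [map_neg, P.reflection_same, P.reflection_apply_self, neg_inj] at this
        exact this
  | zero => rw [smul_zero]; exact zero_mem _
  | one => rw [smul_one]; exact one_mem _
  | add q r _ _ hq hr => rw [smul_add]; exact add_mem hq hr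
  | neg q _ hq => rw [smul_neg]; exact neg_mem hq
  | mul q r _ _ hq hr => rw [smul_mul']; exact mul_mem hq hr

/-- The divided difference operator of `α` preserves `S_α`. -/
lemma invX_mul_sub_smul_mem_localCoefficients (hA : A.IsFormalGroupAlgebra)
    {q : RootLocalization A} (hq : q ∈ localCoefficients A i) :
    invX A i * (q - RootPairing.weylGroup.ofIdx P i • q) ∈ localCoefficients A i := by
  have hS : ∀ s : A.carrier, invX A i * (algebraMap _ _ s -
      RootPairing.weylGroup.ofIdx P i • algebraMap _ _ s) ∈ localCoefficients A i := by
    intro s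
    obtain ⟨r, hr⟩ := hA.x_root_dvd_sub_smul i s
    rw [smul_algebraMap_localization, ← map_sub, hr, map_mul, ← mul_assoc, invX_mul_x, one_mul]
    exact algebraMap_mem_localCoefficients r
  induction hq using Subring.closure_induction with
  | mem q hq =>
    rcases hq with ⟨s, rfl⟩ | ⟨j, ⟨hj, hj'⟩, rfl⟩
    · exact hS s
    · have h1 := hS (A.x (P.root j))
      have h2 := invX_mem_localCoefficients (A := A) hj hj'
      have h3 := ofIdx_smul_mem_localCoefficients h2
      have e1 := invX_mul_x (A := A) j
      have e2 := congrArg (RootPairing.weylGroup.ofIdx P i • ·) e1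
      simp only [smul_mul', smul_one] at e2
      convert neg_mem (mul_mem (mul_mem h1 h2) h3) using 1
      generalize RootPairing.weylGroup.ofIdx P i • invX A j = p' at *
      generalize RootPairing.weylGroup.ofIdx P i •
        (algebraMap A.carrier (RootLocalization A)) (A.x (P.root j)) = a' at *
      linear_combination (invX A i * p') * e1 - (invX A i * invX A j) * e2
  | zero => rw [smul_zero, sub_zero, mul_zero]; exact zero_mem _
  | one => rw [smul_one, sub_self, mul_zero]; exact zero_mem _
  | add q r _ _ hq hr =>
    rw [smul_add, add_sub_add_comm, mul_add]
    exact add_mem hq hr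
  | neg q _ hq =>
    rw [smul_neg, neg_sub_neg, ← neg_sub, mul_neg]
    exact neg_mem hq
  | mul q r hq' hr' hq hr =>
    convert add_mem (mul_mem hq hr')
      (mul_mem (ofIdx_smul_mem_localCoefficients hq') hr) using 1
    rw [smul_mul']
    ring

lemma Coefficients.IsFormalGroupAlgebra.algebraMap_injective (hA : A.IsFormalGroupAlgebra) :
    Function.Injective (algebraMap A.carrier (RootLocalization A)) := by
  have hdom := hA.isDomain
  refine IsLocalization.injective _ (M := rootSubmonoid A)
    fun x hx => mem_nonZeroDivisors_of_ne_zero ?_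
  induction hx using Submonoid.closure_induction with
  | mem _ h => obtain ⟨i, rfl⟩ := h; exact hA.x_root_ne_zero i
  | one => exact one_ne_zero
  | mul x y _ _ hx hy => exact mul_ne_zero hx hy

/-- An element of `Q` that lies in `S_α` for all roots `α` lies in `S`, because the `x_α` are
pairwise coprime. -/
lemma exists_algebraMap_eq_of_forall_mem_localCoefficients (hA : A.IsFormalGroupAlgebra)
    (hcop : ∀ i j, P.root i ≠ P.root j → P.root i ≠ -P.root j → ∀ s : A.carrier,
      A.x (P.root i) ∣ A.x (P.root j) * s → A.x (P.root i) ∣ s) {q : RootLocalization A}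
    (hq : ∀ i, q ∈ localCoefficients A i) : ∃ s : A.carrier, q = algebraMap _ _ s := by
  have hinj := hA.algebraMap_injective
  have hprod : ∀ i, ∀ p ∈ Submonoid.closure
      ((fun j => A.x (P.root j)) '' {j | P.root i ≠ P.root j ∧ P.root i ≠ -P.root j}),
      ∀ s : A.carrier, A.x (P.root i) ∣ p * s → A.x (P.root i) ∣ s := by
    intro i p hp
    induction hp using Submonoid.closure_induction with
    | mem _ h => obtain ⟨j, hj, rfl⟩ := h; exact hcop i j hj.1 hj.2
    | one => intro s hs; rwa [one_mul] at hs
    | mul x y _ _ hx hy => intro s hs; rw [mul_assoc] at hs; exact hy s (hx _ hs)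
  -- cancel the factors `x_α` of a denominator of `q` one at a time
  have hcancel : ∀ x ∈ rootSubmonoid A, ∀ s : A.carrier, algebraMap _ _ x * q = algebraMap _ _ s →
      x ∣ s := by
    intro x hx
    induction hx using Submonoid.closure_induction_right with
    | one => intro s _; exact one_dvd s
    | mul_right x hx y hy ih =>
      obtain ⟨i, rfl⟩ := hy
      intro s hs
      obtain ⟨p, hp, r, hr⟩ := exists_mul_eq_of_mem_localCoefficients (hq i)
      have h1 : p * s = A.x (P.root i) * (x * r) := by
        apply hinj
        simp only [map_mul, ← hs, ← hr]
        ring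
      obtain ⟨s', rfl⟩ := hprod i p hp s ⟨_, h1⟩
      rw [mul_comm x]
      refine mul_dvd_mul_left _ (ih s' ?_)
      refine (isUnit_x i).mul_left_cancel ?_
      rw [← map_mul, ← hs, map_mul]
      ring
  obtain ⟨⟨a, x⟩, hx⟩ := IsLocalization.surj (rootSubmonoid A) q
  simp only at hx
  obtain ⟨s, rfl⟩ := hcancel x x.2 a (by rw [mul_comm]; exact hx)
  refine ⟨s, (IsLocalization.map_units (RootLocalization A) x).mul_right_cancel ?_⟩
  rw [hx, map_mul, mul_comm]

end LocalCoefficients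

/-! ### Straightening products in the Demazure algebra -/

section Straightening

variable {ι M N : Type v} [AddCommGroup M] [AddCommGroup N] {P : RootPairing ι ℤ M N}
  (A : Coefficients.{u, v} P) (i : ι)

/-- The left `S_α`-submodule of `Q_{W_a}` spanned by all `Z_α ^ d η_w` and `Z_α ^ d X_α η_w`. -/
def straightModule : AddSubgroup (TwistedGroupAlgebra A) :=
  AddSubgroup.closure {z | ∃ c ∈ localCoefficients A i, ∃ (d : ℕ) (w : AffineWeylGroup P),
    z = scalar A c * (translationElement A i ^ d * eta A w) ∨
    z = scalar A c * (translationElement A i ^ d * (demazureElement A i * eta A w))}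

/-- The elements of `Q_{W_a}` that preserve `straightModule` under left multiplication. -/
def leftStabilizer : Subring (TwistedGroupAlgebra A) where
  carrier := {y | ∀ z ∈ straightModule A i, y * z ∈ straightModule A i}
  mul_mem' hy hy' z hz := by rw [mul_assoc]; exact hy _ (hy' z hz)
  one_mem' z hz := by rwa [one_mul]
  add_mem' hy hy' z hz := by rw [add_mul]; exact add_mem (hy z hz) (hy' z hz)
  zero_mem' z _ := by rw [zero_mul]; exact zero_mem _
  neg_mem' hy z hz := by rw [neg_mul _ z]; exact neg_mem (hy z hz)

variable {A i}

lemma mul_mem_straightModule {y z : TwistedGroupAlgebra A} (hy : y ∈ leftStabilizer A i)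
    (hz : z ∈ straightModule A i) : y * z ∈ straightModule A i :=
  hy z hz

lemma mem_leftStabilizer {y : TwistedGroupAlgebra A}
    (h₁ : ∀ c ∈ localCoefficients A i, ∀ (d : ℕ) (w : AffineWeylGroup P),
      y * (scalar A c * (translationElement A i ^ d * eta A w)) ∈ straightModule A i)
    (h₂ : ∀ c ∈ localCoefficients A i, ∀ (d : ℕ) (w : AffineWeylGroup P),
      y * (scalar A c * (translationElement A i ^ d * (demazureElement A i * eta A w))) ∈
        straightModule A i) :
    y ∈ leftStabilizer A i := by
  intro z hz
  induction hz using AddSubgroup.closure_induction with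
  | mem z hz =>
    obtain ⟨c, hc, d, w, rfl | rfl⟩ := hz
    · exact h₁ c hc d w
    · exact h₂ c hc d w
  | zero => rw [mul_zero]; exact zero_mem _
  | add z z' _ _ hz hz' => rw [mul_add]; exact add_mem hz hz'
  | neg z _ hz => rw [mul_neg y z]; exact neg_mem hz

lemma scalar_mem_leftStabilizer {c : RootLocalization A} (hc : c ∈ localCoefficients A i) :
    scalar A c ∈ leftStabilizer A i := by
  refine mem_leftStabilizer (fun c' hc' d w => ?_) (fun c' hc' d w => ?_)
  all_goals
    rw [← mul_assoc, ← map_mul]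
    refine AddSubgroup.subset_closure ⟨c * c', mul_mem hc hc', d, w, ?_⟩
    simp

lemma scalar_algebraMap_mem_leftStabilizer (s : A.carrier) :
    scalar A (algebraMap _ _ s) ∈ leftStabilizer A i :=
  scalar_mem_leftStabilizer (algebraMap_mem_localCoefficients s)

lemma translationElement_mul_scalar (c : RootLocalization A) :
    translationElement A i * scalar A c = scalar A c * translationElement A i :=
  (commute_rankOne (by rw [← map_mul, ← map_mul, mul_comm])
    (eta_translation_mul_scalar A i c).symm).eq.symm

lemma translationElement_mem_leftStabilizer : translationElement A i ∈ leftStabilizer A i := by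
  refine mem_leftStabilizer (fun c hc d w => ?_) (fun c hc d w => ?_)
  all_goals
    rw [← mul_assoc, translationElement_mul_scalar, mul_assoc, ← mul_assoc _ (_ ^ d), ← pow_succ']
    refine AddSubgroup.subset_closure ⟨c, hc, d + 1, w, ?_⟩
    simp

lemma eta_mem_straightModule (w : AffineWeylGroup P) : eta A w ∈ straightModule A i :=
  AddSubgroup.subset_closure ⟨1, one_mem _, 0, w, Or.inl (by simp)⟩

lemma demazureElement_mul_eta_mem_straightModule (w : AffineWeylGroup P) :
    demazureElement A i * eta A w ∈ straightModule A i :=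
  AddSubgroup.subset_closure ⟨1, one_mem _, 0, w, Or.inr (by simp)⟩

lemma mem_leftStabilizer_of_commute {y : TwistedGroupAlgebra A}
    (hc : ∀ c, Commute y (scalar A c)) (hZ : Commute y (translationElement A i))
    (h₁ : ∀ w : AffineWeylGroup P, y * eta A w ∈ straightModule A i)
    (h₂ : ∀ w : AffineWeylGroup P, y * (demazureElement A i * eta A w) ∈ straightModule A i) :
    y ∈ leftStabilizer A i := by
  refine mem_leftStabilizer (fun c hc' d w => ?_) (fun c hc' d w => ?_)
  all_goals
    rw [← mul_assoc, (hc c).eq, mul_assoc, ← mul_assoc y, (hZ.pow_right d).eq, mul_assoc]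
    refine mul_mem_straightModule (scalar_mem_leftStabilizer hc') (mul_mem_straightModule
      (pow_mem translationElement_mem_leftStabilizer d) ?_)
  · exact h₁ w
  · exact h₂ w

lemma eta_translation_mem_leftStabilizer :
    eta A (translation P i) ∈ leftStabilizer A i := by
  refine mem_leftStabilizer_of_commute (eta_translation_mul_scalar A i)
    (commute_rankOne (eta_translation_mul_scalar A i _) rfl) (fun w => ?_) (fun w => ?_)
  · rw [← eta_mul]
    exact eta_mem_straightModule _
  · rw [rankOne_translation_mul (Z := translationElement A i) (t' := eta A (translation P i)⁻¹) rfl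
      (demazureElement_eq A i) (by rw [← eta_mul, ← eta_mul, rootReflection_mul_translation_inv])
      (eta_mul_eta_inv A _) (eta_translation_mul_scalar A i _), ← eta_mul]
    exact sub_mem (demazureElement_mul_eta_mem_straightModule _)
      (mul_mem_straightModule translationElement_mem_leftStabilizer
        (add_mem (eta_mem_straightModule _) (eta_mem_straightModule _)))

lemma eta_translation_inv_mem_leftStabilizer :
    eta A (translation P i)⁻¹ ∈ leftStabilizer A i := by
  refine mem_leftStabilizer_of_commute (eta_translation_inv_mul_scalar A i)
    (commute_rankOne (eta_translation_inv_mul_scalar A i _)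
      (by rw [eta_inv_mul_eta, eta_mul_eta_inv])) (fun w => ?_) (fun w => ?_)
  · rw [← eta_mul]
    exact eta_mem_straightModule _
  · rw [rankOne_translation_inv_mul (Z := translationElement A i) (t := eta A (translation P i)) rfl
      (demazureElement_eq A i) (by rw [← eta_mul, ← eta_mul, rootReflection_mul_translation])
      (eta_mul_eta_inv A _) (eta_translation_inv_mul_scalar A i _), ← eta_mul, ← eta_mul]
    exact add_mem (demazureElement_mul_eta_mem_straightModule _)
      (mul_mem_straightModule translationElement_mem_leftStabilizer
        (add_mem (eta_mem_straightModule _) (eta_mem_straightModule _)))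

lemma demazureElement_mul_scalar_mul (c : RootLocalization A) (z : TwistedGroupAlgebra A) :
    demazureElement A i * (scalar A c * z) =
      scalar A (RootPairing.weylGroup.ofIdx P i • c) * (demazureElement A i * z) +
        scalar A (invX A i * (c - RootPairing.weylGroup.ofIdx P i • c)) * z := by
  have h : eta A (rootReflection P i) * scalar A c =
      scalar A (RootPairing.weylGroup.ofIdx P i • c) * eta A (rootReflection P i) :=
    eta_mul_scalar A _ c
  rw [rankOne_mul_scalar (demazureElement_eq A i) h (by rw [← map_mul, ← map_mul, mul_comm]),
    map_mul, map_sub]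

/-- `X_α` preserves the module spanned by the `Z_α ^ d η_w` and `Z_α ^ d X_α η_w`: it can be moved
to the right past powers of `Z_α`. -/
lemma demazureElement_mem_leftStabilizer (hA : A.IsFormalGroupAlgebra) :
    demazureElement A i ∈ leftStabilizer A i := by
  obtain ⟨v, hv⟩ := hA.exists_invX_neg i
  obtain ⟨g, hg⟩ := hA.exists_invX_add_invX_neg i
  have hXZ := rankOne_mul_translation (X := demazureElement A i) (Z := translationElement A i)
    (p := scalar A (invX A i)) (m := scalar A (invX A (P.reflectionPerm i i)))
    (v := scalar A (algebraMap _ _ v)) (t' := eta A (translation P i)⁻¹) rfl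
    (demazureElement_eq A i) (eta_rootReflection_mul_scalar_invX A i)
    (by rw [← eta_mul, ← eta_mul, rootReflection_mul_translation]) (eta_mul_eta_inv A _)
    (eta_inv_mul_eta A _) (eta_translation_mul_scalar A i _) (eta_translation_mul_scalar A i _)
    (eta_translation_inv_mul_scalar A i _) (by rw [← map_mul, hv])
  have hXX := rankOne_mul_self (demazureElement_eq A i) (eta_rootReflection_mul_scalar_invX A i)
    (by rw [← eta_mul, rootReflection_mul_self, eta_one])
    (by rw [← map_mul, ← map_mul, mul_comm])
  rw [← map_add, hg] at hXZ hXX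
  have hvT : scalar A (algebraMap _ _ v) * eta A (translation P i)⁻¹ ∈ leftStabilizer A i :=
    mul_mem (scalar_algebraMap_mem_leftStabilizer v) eta_translation_inv_mem_leftStabilizer
  have hpow : ∀ (d : ℕ) (z : TwistedGroupAlgebra A), z ∈ straightModule A i →
      demazureElement A i * z ∈ straightModule A i →
      demazureElement A i * (translationElement A i ^ d * z) ∈ straightModule A i := by
    intro d z hz hXz
    induction d with
    | zero => rwa [pow_zero, one_mul]
    | succ d ih =>
      rw [pow_succ', mul_assoc, hXZ]
      refine mul_mem_straightModule translationElement_mem_leftStabilizer ?_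
      have hz' := mul_mem_straightModule
        (pow_mem (translationElement_mem_leftStabilizer (A := A) (i := i)) d) hz
      exact sub_mem (add_mem
        (mul_mem_straightModule (scalar_algebraMap_mem_leftStabilizer g) hz')
        (mul_mem_straightModule hvT
          (mul_mem_straightModule translationElement_mem_leftStabilizer hz')))
        (mul_mem_straightModule hvT ih)
  have hscalar : ∀ c ∈ localCoefficients A i, ∀ z, z ∈ straightModule A i →
      demazureElement A i * z ∈ straightModule A i →
      demazureElement A i * (scalar A c * z) ∈ straightModule A i := by
    intro c hc z hz hXz
    rw [demazureElement_mul_scalar_mul]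
    exact add_mem
      (mul_mem_straightModule (scalar_mem_leftStabilizer (ofIdx_smul_mem_localCoefficients hc)) hXz)
      (mul_mem_straightModule
        (scalar_mem_leftStabilizer (invX_mul_sub_smul_mem_localCoefficients hA hc)) hz)
  refine mem_leftStabilizer (fun c hc d w => ?_) (fun c hc d w => ?_)
  · have h := eta_mem_straightModule (A := A) (i := i) w
    exact hscalar c hc _ (mul_mem_straightModule (pow_mem translationElement_mem_leftStabilizer d) h)
      (hpow d _ h (demazureElement_mul_eta_mem_straightModule w))
  · have h := demazureElement_mul_eta_mem_straightModule (A := A) (i := i) w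
    refine hscalar c hc _
      (mul_mem_straightModule (pow_mem translationElement_mem_leftStabilizer d) h) (hpow d _ h ?_)
    rw [hXX]
    exact mul_mem_straightModule (scalar_algebraMap_mem_leftStabilizer g) h

lemma eta_translation_zpow_mem_leftStabilizer (k : ℤ) :
    eta A (translation P i ^ k) ∈ leftStabilizer A i := by
  induction k using Int.induction_on with
  | zero => rw [zpow_zero, eta_one]; exact one_mem _
  | succ n ih =>
    rw [zpow_add_one, eta_mul]
    exact mul_mem ih eta_translation_mem_leftStabilizer
  | pred n ih =>
    rw [zpow_sub_one, eta_mul]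
    exact mul_mem ih eta_translation_inv_mem_leftStabilizer

lemma one_sub_eta_translation_zpow_mem_leftStabilizer (k : ℤ) :
    scalar A (invX A i) * (1 - eta A (translation P i ^ k)) ∈ leftStabilizer A i := by
  have h : ∀ k : ℤ, scalar A (invX A i) * (1 - eta A (translation P i ^ (k + 1))) =
      scalar A (invX A i) * (1 - eta A (translation P i ^ k)) +
        translationElement A i * eta A (translation P i ^ k) := by
    intro k
    rw [zpow_add_one, eta_mul, mul_one_sub_mul _ _ _ (by
      rw [translation_eq, ← translate_zsmul, eta_translate_mul_scalar])]
    congr 1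
    exact ((commute_rankOne (by
      rw [translation_eq, ← translate_zsmul, eta_translate_mul_scalar]) (by
      rw [← eta_mul, ← eta_mul, mul_zpow_self, mul_self_zpow]) :
        Commute (eta A (translation P i ^ k)) (translationElement A i))).eq
  have hZ : ∀ k : ℤ, translationElement A i * eta A (translation P i ^ k) ∈ leftStabilizer A i :=
    fun k => mul_mem translationElement_mem_leftStabilizer
      (eta_translation_zpow_mem_leftStabilizer k)
  induction k using Int.induction_on with
  | zero => rw [zpow_zero, eta_one, sub_self, mul_zero]; exact zero_mem _
  | succ n ih => rw [h]; exact add_mem ih (hZ _)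
  | pred n ih =>
    have := h (-(n : ℤ) - 1)
    rw [sub_add_cancel] at this
    rw [eq_sub_of_add_eq this.symm]
    exact sub_mem ih (hZ _)

/-- All real root reflections of the affine Weyl group are of the form `t_{β^∨} ^ k s_β`; the
corresponding divided differences preserve `straightModule`. -/
lemma divided_difference_mem_straightModule (hA : A.IsFormalGroupAlgebra) (j : ι) (k : ℤ)
    (w : AffineWeylGroup P) :
    scalar A (invX A j) * (1 - eta A (translation P j ^ k * rootReflection P j)) * eta A w ∈
      straightModule A i := by
  have hi : ∀ k : ℤ, scalar A (invX A i) *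
      (1 - eta A (translation P i ^ k * rootReflection P i)) ∈ leftStabilizer A i := by
    intro k
    rw [eta_mul, mul_one_sub_mul _ _ _ (by
      rw [translation_eq, ← translate_zsmul, eta_translate_mul_scalar]), ← demazureElement_eq]
    exact add_mem (one_sub_eta_translation_zpow_mem_leftStabilizer k)
      (mul_mem (eta_translation_zpow_mem_leftStabilizer k) (demazureElement_mem_leftStabilizer hA))
  by_cases h : P.root i = P.root j
  · obtain rfl := P.root.injective h
    exact mul_mem_straightModule (hi k) (eta_mem_straightModule w)
  by_cases h' : P.root i = -P.root j
  · obtain rfl : j = P.reflectionPerm i i :=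
      P.root.injective (by rw [root_reflectionPerm_self, h', neg_neg])
    obtain ⟨v, hv⟩ := hA.exists_invX_neg i
    rw [← hv, translation_reflectionPerm_self, inv_zpow', rootReflection,
      ofIdx_reflectionPerm_self, map_mul, mul_assoc (scalar A _)]
    exact mul_mem_straightModule (mul_mem (scalar_algebraMap_mem_leftStabilizer v) (hi (-k)))
      (eta_mem_straightModule w)
  · rw [mul_assoc, sub_mul, one_mul, ← eta_mul]
    exact mul_mem_straightModule (scalar_mem_leftStabilizer (invX_mem_localCoefficients h h'))
      (sub_mem (eta_mem_straightModule _) (eta_mem_straightModule _))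

/-- Up to the denominators `x_β` with `β ≠ ±α`, every element of `D_{W_a}` is a combination of the
elements `Z_α ^ d η_w` and `Z_α ^ d X_α η_w`. -/
lemma demazureAlgebra_le_straightModule (hA : A.IsFormalGroupAlgebra) {b : P.Base} {θ : ι}
    {z : TwistedGroupAlgebra A} (hz : z ∈ demazureAlgebra A b θ) : z ∈ straightModule A i := by
  have key : ∀ g : TwistedGroupAlgebra A, (∀ w, eta A w * g ∈ straightModule A i) →
      ∀ y ∈ straightModule A i, y * g ∈ straightModule A i := by
    intro g hg y hy
    induction hy using AddSubgroup.closure_induction with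
    | mem z hz =>
      obtain ⟨c, hc, d, w, rfl | rfl⟩ := hz
      · simp only [mul_assoc]
        exact mul_mem_straightModule (scalar_mem_leftStabilizer hc) (mul_mem_straightModule
          (pow_mem translationElement_mem_leftStabilizer d) (hg w))
      · simp only [mul_assoc]
        exact mul_mem_straightModule (scalar_mem_leftStabilizer hc) (mul_mem_straightModule
          (pow_mem translationElement_mem_leftStabilizer d)
            (mul_mem_straightModule (demazureElement_mem_leftStabilizer hA) (hg w)))
    | zero => rw [zero_mul]; exact zero_mem _
    | add z z' _ _ hz hz' => rw [add_mul]; exact add_mem hz hz'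
    | neg z _ hz => rw [neg_mul z g]; exact neg_mem hz
  -- an element of `W_a` conjugates the reflection `t_{γ^∨} ^ l s_γ` to one of the same form
  have hconj : ∀ (w : AffineWeylGroup P) (j : ι), ∃ k : ℤ,
      w * rootReflection P j * w⁻¹ = translation P (P.weylGroupToPerm w.right j) ^ k *
        rootReflection P (P.weylGroupToPerm w.right j) := by
    intro w j
    obtain ⟨n, hn⟩ := eq_translate_mul_inr P w
    refine ⟨P.toLinearMap (P.root (P.weylGroupToPerm w.right j)) n, ?_⟩
    rw [← translate_mul_rootReflection_mul_inv, ← inr_mul_rootReflection_mul_inv]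
    conv_lhs => rw [hn]
    group
  have hconjt : ∀ (w : AffineWeylGroup P) (j : ι),
      w * translation P j * w⁻¹ = translation P (P.weylGroupToPerm w.right j) := by
    intro w j
    obtain ⟨n, hn⟩ := eq_translate_mul_inr P w
    rw [← inr_mul_translation_mul_inv]
    conv_lhs => rw [hn]
    have : translate P n * (SemidirectProduct.inr w.right * translation P j *
        (SemidirectProduct.inr w.right)⁻¹) * (translate P n)⁻¹ =
        SemidirectProduct.inr w.right * translation P j * (SemidirectProduct.inr w.right)⁻¹ := by
      rw [inr_mul_translation_mul_inv, translation_eq, ← translate_neg, ← translate_add,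
        ← translate_add, add_neg_cancel_comm]
    rw [← this]
    group
  suffices h : ∀ y ∈ straightModule A i, y * z ∈ straightModule A i by
    simpa [eta_one] using h _ (eta_mem_straightModule 1)
  induction hz using Subring.closure_induction with
  | mem g hg =>
    refine key g fun w => ?_
    rcases hg with (⟨s, rfl⟩ | ⟨j, hj, rfl⟩) | rfl
    · have e : s • (1 : TwistedGroupAlgebra A) = scalar A (algebraMap _ _ s) := by
        rw [← scalar_algebraMap_mul, mul_one]
      simp only [e]
      rw [eta_mul_scalar, affine_smul_localization, smul_algebraMap_localization]
      exact mul_mem_straightModule (scalar_algebraMap_mem_leftStabilizer _)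
        (eta_mem_straightModule w)
    · obtain ⟨k, hk⟩ := hconj w j
      rw [demazureElement_eq, eta_mul_scalar_mul_one_sub, hk]
      exact divided_difference_mem_straightModule hA _ k w
    · obtain ⟨k, hk⟩ := hconj w θ
      have e : w * affineRefl P θ * w⁻¹ = translation P (P.weylGroupToPerm w.right θ) ^ (1 + k) *
          rootReflection P (P.weylGroupToPerm w.right θ) := by
        rw [zpow_one_add, mul_assoc (translation P _), ← hk, ← hconjt, affineRefl]
        group
      obtain ⟨v, hv⟩ := hA.exists_invX_neg (P.weylGroupToPerm w.right θ)
      have e' : P.weylGroupToPerm w.right (P.reflectionPerm θ θ) =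
          P.reflectionPerm (P.weylGroupToPerm w.right θ) (P.weylGroupToPerm w.right θ) :=
        P.root.injective (by
          rw [root_reflectionPerm_self, ← RootPairing.weylGroup_apply_root,
            ← RootPairing.weylGroup_apply_root, root_reflectionPerm_self, smul_neg])
      rw [affineDemazureElement_eq, eta_mul_scalar_mul_one_sub, e, e', ← hv, map_mul,
        mul_assoc (scalar A _), mul_assoc (scalar A (algebraMap _ _ v))]
      exact mul_mem_straightModule (scalar_algebraMap_mem_leftStabilizer v)
        (divided_difference_mem_straightModule hA _ _ w)
  | zero => intro y _; rw [mul_zero]; exact zero_mem _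
  | one => intro y hy; rwa [mul_one]
  | add g g' _ _ hg hg' => intro y hy; rw [mul_add]; exact add_mem (hg y hy) (hg' y hy)
  | neg g _ hg => intro y hy; rw [mul_neg y g]; exact neg_mem (hg y hy)
  | mul g g' _ _ hg hg' => intro y hy; rw [← mul_assoc]; exact hg' _ (hg y hy)

end Straightening

/-! ### Duals and invariants -/

section Duals

variable {ι M N : Type v} [AddCommGroup M] [AddCommGroup N] {P : RootPairing ι ℤ M N}
  {A : Coefficients.{u, v} P} {b : P.Base} {θ : ι}

lemma map_scalar_mul (f : TwistedDual A) (q : RootLocalization A) (z : TwistedGroupAlgebra A) :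
    f (scalar A q * z) = q * f z := by
  rw [scalar_mul, map_smul, smul_eq_mul]

lemma twistedDual_ext {f g : TwistedDual A} (h : ∀ w, f (eta A w) = g (eta A w)) : f = g := by
  refine LinearMap.ext fun z => ?_
  induction z using twisted_induction with
  | zero => rw [map_zero, map_zero]
  | add y z hy hz => rw [map_add, map_add, hy, hz]
  | smul_eta q w => rw [map_scalar_mul, map_scalar_mul, h]

lemma exists_twistedDual (a : AffineWeylGroup P → RootLocalization A) :
    ∃ f : TwistedDual A, ∀ w, f (eta A w) = a w := by
  refine ⟨SkewMonoidAlgebra.basisSingleOne.constr (RootLocalization A) a, fun w => ?_⟩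
  have h : eta A w = SkewMonoidAlgebra.basisSingleOne (k := RootLocalization A) w := rfl
  rw [h, Module.Basis.constr_basis]

/-- If all `η_w` lie in `D_{W_a}`, then a form on `D_{W_a}` extends uniquely to `Q_{W_a}`: every
element of `Q_{W_a}` has a multiple by a product of elements `x_α` that is an `S`-linear combination
of the `η_w`. -/
lemma existsUnique_extends (hη : ∀ w, eta A w ∈ demazureAlgebra A b θ) (φ : DemazureDual A b θ) :
    ∃! f : TwistedDual A, Extends f φ := by
  obtain ⟨f, hf⟩ := exists_twistedDual (A := A)
    fun w => algebraMap _ _ (φ (⟨eta A w, hη w⟩ : demazureModule A b θ))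
  refine ⟨f, ?_, fun g hg => twistedDual_ext fun w => ?_⟩
  · have key : ∀ z : TwistedGroupAlgebra A, ∃ s ∈ rootSubmonoid A, ∃ y : demazureModule A b θ,
        (y : TwistedGroupAlgebra A) = scalar A (algebraMap _ _ s) * z ∧
          f y = algebraMap _ _ (φ y) := by
      intro z
      have hsmul : ∀ (s : A.carrier) (y : demazureModule A b θ), f y = algebraMap _ _ (φ y) →
          f (s • y : demazureModule A b θ) = algebraMap _ _ (φ (s • y)) := by
        intro s y hy
        rw [Submodule.coe_smul, ← scalar_algebraMap_mul, map_scalar_mul, hy, map_smul,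
          smul_eq_mul, map_mul]
      induction z using twisted_induction with
      | zero => exact ⟨1, one_mem _, 0, by simp, by simp⟩
      | add y z hy hz =>
        obtain ⟨s, hs, y', hy', h1⟩ := hy
        obtain ⟨r, hr, z', hz', h2⟩ := hz
        refine ⟨s * r, mul_mem hs hr, r • y' + s • z', ?_, ?_⟩
        · rw [Submodule.coe_add, Submodule.coe_smul, Submodule.coe_smul, hy', hz',
            ← scalar_algebraMap_mul, ← scalar_algebraMap_mul, ← mul_assoc, ← mul_assoc, ← map_mul,
            ← map_mul, ← map_mul, ← map_mul, mul_comm r s, mul_add]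
        · rw [Submodule.coe_add, map_add, hsmul r y' h1, hsmul s z' h2, map_add, map_add]
      | smul_eta q w =>
        obtain ⟨⟨a, s⟩, h⟩ := IsLocalization.surj (rootSubmonoid A) q
        refine ⟨s, s.2, a • ⟨eta A w, hη w⟩, ?_, hsmul _ _ (hf w)⟩
        rw [Submodule.coe_smul, ← scalar_algebraMap_mul, ← mul_assoc, ← map_mul, ← h]
        rw [mul_comm q]
    intro z
    obtain ⟨s, hs, y, hy, h⟩ := key z
    obtain rfl : y = s • z := Subtype.ext (by
      rw [hy, Submodule.coe_smul, scalar_algebraMap_mul])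
    refine (IsLocalization.map_units (RootLocalization A) ⟨s, hs⟩).mul_left_cancel ?_
    rw [← map_scalar_mul, ← hy, h, map_smul, smul_eq_mul, map_mul]
  · rw [hf]
    exact hg ⟨eta A w, hη w⟩

/-- A form belongs to `D_{W_a}^*` when it takes values in `S` on `D_{W_a}`. -/
lemma mem_demazureDual_of_forall (hinj : Function.Injective
      (algebraMap A.carrier (RootLocalization A))) {f : TwistedDual A}
    (h : ∀ z ∈ demazureAlgebra A b θ, ∃ s : A.carrier, f z = algebraMap _ _ s) :
    f ∈ demazureDual A b θ := by
  choose g hg using fun z : demazureModule A b θ => h z z.2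
  refine ⟨⟨⟨g, fun y z => hinj ?_⟩, fun s z => hinj ?_⟩, hg⟩
  · rw [← hg, map_add, ← hg, ← hg, Submodule.coe_add, map_add]
  · rw [← hg, Submodule.coe_smul, ← scalar_algebraMap_mul, map_scalar_mul, hg, RingHom.id_apply,
      smul_eq_mul, map_mul]

lemma memMultiples_x_pow {i : ι} {d : ℕ} {q : RootLocalization A} :
    MemMultiples (A.x (P.root i) ^ d) q ↔ ∃ a : A.carrier, invX A i ^ d * q = algebraMap _ _ a := by
  have h : invX A i ^ d * algebraMap _ _ (A.x (P.root i) ^ d) = 1 := by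
    rw [map_pow, ← mul_pow, invX_mul_x, one_pow]
  refine exists_congr fun a => ⟨fun ha => ?_, fun ha => ?_⟩
  · rw [ha, map_mul, ← mul_assoc, h, one_mul]
  · rw [map_mul, ← ha, ← mul_assoc, mul_comm (algebraMap _ _ _), h, one_mul]

lemma MemMultiples.add {s : A.carrier} {q r : RootLocalization A} (hq : MemMultiples s q)
    (hr : MemMultiples s r) : MemMultiples s (q + r) := by
  obtain ⟨a, rfl⟩ := hq
  obtain ⟨c, rfl⟩ := hr
  exact ⟨a + c, by rw [mul_add, map_add]⟩

lemma MemMultiples.neg {s : A.carrier} {q : RootLocalization A} (hq : MemMultiples s q) :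
    MemMultiples s (-q) := by
  obtain ⟨a, rfl⟩ := hq
  exact ⟨-a, by rw [mul_neg, map_neg]⟩

lemma map_translationElement_pow_mul (f : TwistedDual A) (i : ι) (d : ℕ)
    (z : TwistedGroupAlgebra A) : f (translationElement A i ^ d * z) =
      invX A i ^ d * f ((1 - eta A (translation P i)) ^ d * z) := by
  rw [translationElement_pow, mul_assoc, map_scalar_mul]

lemma map_translationElement_pow_mul_demazureElement_mul (f : TwistedDual A) (i : ι) (d : ℕ)
    (z : TwistedGroupAlgebra A) :
    f (translationElement A i ^ d * (demazureElement A i * z)) = invX A i ^ (d + 1) *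
      f ((1 - eta A (translation P i)) ^ d * (1 - eta A (rootReflection P i)) * z) := by
  have hc : Commute ((1 - eta A (translation P i)) ^ d) (scalar A (invX A i)) :=
    ((Commute.one_left _).sub_left (eta_translation_mul_scalar A i _)).pow_left d
  rw [map_translationElement_pow_mul, demazureElement_eq, mul_assoc, ← mul_assoc _ (scalar A _),
    hc.eq, mul_assoc, map_scalar_mul, pow_succ]
  simp only [mul_assoc]

/-- The conditions that characterize `D_{W_a}^*` say that a form is `S`-valued on the elements
`Z_α ^ d η_w` and `Z_α ^ d X_α η_w`. Hence they hold for a form on `D_{W_a}`, and conversely they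
imply that the form maps `D_{W_a}` to every `S_α`, hence to `S`. -/
lemma mem_demazureDual_iff (hA : A.IsFormalGroupAlgebra)
    (hcop : ∀ i j, P.root i ≠ P.root j → P.root i ≠ -P.root j → ∀ s : A.carrier,
      A.x (P.root i) ∣ A.x (P.root j) * s → A.x (P.root i) ∣ s)
    (hη : ∀ w, eta A w ∈ demazureAlgebra A b θ)
    (hX : ∀ i, demazureElement A i ∈ demazureAlgebra A b θ)
    (hZ : ∀ i, translationElement A i ∈ demazureAlgebra A b θ) {f : TwistedDual A} :
    f ∈ demazureDual A b θ ↔ (∀ w : AffineWeylGroup P, MemMultiples 1 (f (eta A w))) ∧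
      ∀ (i : ι) (w : AffineWeylGroup P) (d : ℕ), 1 ≤ d →
        MemMultiples (A.x (P.root i) ^ d)
          (f ((1 - eta A (translation P i)) ^ d * eta A w)) ∧
        MemMultiples (A.x (P.root i) ^ d)
          (f ((1 - eta A (translation P i)) ^ (d - 1) * (1 - eta A (rootReflection P i)) *
            eta A w)) := by
  constructor
  · rintro ⟨φ, hφ⟩
    have hD : ∀ z ∈ demazureAlgebra A b θ, ∃ a : A.carrier, f z = algebraMap _ _ a :=
      fun z hz => ⟨_, hφ ⟨z, hz⟩⟩
    refine ⟨fun w => ?_, fun i w d hd => ⟨?_, ?_⟩⟩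
    · obtain ⟨a, ha⟩ := hD _ (hη w)
      exact ⟨a, by rw [ha, one_mul]⟩
    · rw [memMultiples_x_pow, ← map_translationElement_pow_mul]
      exact hD _ (mul_mem (pow_mem (hZ i) d) (hη w))
    · obtain ⟨d, rfl⟩ := Nat.exists_eq_add_of_le' hd
      rw [memMultiples_x_pow, Nat.add_sub_cancel,
        ← map_translationElement_pow_mul_demazureElement_mul]
      exact hD _ (mul_mem (pow_mem (hZ i) d) (mul_mem (hX i) (hη w)))
  · rintro ⟨h0, h⟩
    refine mem_demazureDual_of_forall hA.algebraMap_injective fun z hz =>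
      exists_algebraMap_eq_of_forall_mem_localCoefficients hA hcop fun i => ?_
    have hz' := demazureAlgebra_le_straightModule (i := i) hA hz
    clear hz
    induction hz' using AddSubgroup.closure_induction with
    | mem z hz =>
      obtain ⟨c, hc, d, w, rfl | rfl⟩ := hz
      · rw [map_scalar_mul]
        refine mul_mem hc ?_
        have hd : MemMultiples (A.x (P.root i) ^ d)
            (f ((1 - eta A (translation P i)) ^ d * eta A w)) := by
          rcases Nat.eq_zero_or_pos d with rfl | hd
          · simpa using h0 w
          · exact (h i w d hd).1
        obtain ⟨a, ha⟩ := memMultiples_x_pow.1 hd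
        rw [map_translationElement_pow_mul, ha]
        exact algebraMap_mem_localCoefficients a
      · rw [map_scalar_mul]
        refine mul_mem hc ?_
        obtain ⟨a, ha⟩ := memMultiples_x_pow.1 (h i w (d + 1) (Nat.le_add_left 1 d)).2
        rw [Nat.add_sub_cancel] at ha
        rw [map_translationElement_pow_mul_demazureElement_mul, ha]
        exact algebraMap_mem_localCoefficients a
    | zero => rw [map_zero]; exact zero_mem _
    | add y z _ _ hy hz => rw [map_add]; exact add_mem hy hz
    | neg z _ hz => rw [map_neg]; exact neg_mem hz

/-- For a `W`-invariant form, the reflection `s_α` can be traded for a power of the translation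
`t_{α^∨}`, as `s_α t_n = t_{n - ⟨α, n⟩ α^∨} s_α`. The second family of conditions then follows
from the first. -/
lemma memMultiples_of_mem_weylInvariants {f : TwistedDual A} (hf : f ∈ weylInvariants A) {i : ι}
    {d : ℕ} (h : ∀ w : AffineWeylGroup P, MemMultiples (A.x (P.root i) ^ (d + 1))
      (f ((1 - eta A (translation P i)) ^ (d + 1) * eta A w))) (w : AffineWeylGroup P) :
    MemMultiples (A.x (P.root i) ^ (d + 1))
      (f ((1 - eta A (translation P i)) ^ d * (1 - eta A (rootReflection P i)) * eta A w)) := by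
  have hinv : ∀ (z : TwistedGroupAlgebra A) (v : P.weylGroup),
      f (z * eta A (SemidirectProduct.inr v)) = f z := fun z v =>
    LinearMap.congr_fun (hf v) z
  have hstep : ∀ m : N, (1 - eta A (translation P i)) ^ (d + 1) * eta A (translate P m) =
      (1 - eta A (translation P i)) ^ d * eta A (translate P m) -
        (1 - eta A (translation P i)) ^ d * eta A (translate P (P.coroot i + m)) := by
    intro m
    rw [translate_add, ← translation_eq, eta_mul, pow_succ, mul_assoc, sub_mul, one_mul, mul_sub]
  have hdiff : ∀ (k : ℤ) (m : N), MemMultiples (A.x (P.root i) ^ (d + 1))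
      (f ((1 - eta A (translation P i)) ^ d * eta A (translate P m)) -
        f ((1 - eta A (translation P i)) ^ d * eta A (translate P (m - k • P.coroot i)))) := by
    have hone : ∀ (k : ℤ) (m : N), MemMultiples (A.x (P.root i) ^ (d + 1))
        (f ((1 - eta A (translation P i)) ^ d * eta A (translate P (m - (k + 1) • P.coroot i))) -
          f ((1 - eta A (translation P i)) ^ d * eta A (translate P (m - k • P.coroot i)))) := by
      intro k m
      have := h (translate P (m - (k + 1) • P.coroot i))
      rw [hstep, map_sub] at this
      convert this using 7
      module
    intro k m
    induction k using Int.induction_on with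
    | zero => exact ⟨0, by simp⟩
    | succ k ih =>
      convert ih.add (hone k m).neg using 1
      ring
    | pred k ih =>
      have := hone (-(k : ℤ) - 1) m
      rw [sub_add_cancel] at this
      convert ih.add this using 1
      ring
  obtain ⟨n, hn⟩ := eq_translate_mul_inr P w
  have e : (1 - eta A (translation P i)) ^ d * (1 - eta A (rootReflection P i)) * eta A w =
      (1 - eta A (translation P i)) ^ d * eta A (translate P n) *
        eta A (SemidirectProduct.inr w.right) -
      (1 - eta A (translation P i)) ^ d *
        eta A (translate P (n - P.toLinearMap (P.root i) n • P.coroot i)) *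
        eta A (SemidirectProduct.inr (RootPairing.weylGroup.ofIdx P i * w.right)) := by
    conv_lhs => rw [hn]
    rw [map_mul, ← rootReflection, eta_mul (w := translate P n), mul_assoc, sub_mul, one_mul,
      ← mul_assoc (eta A (rootReflection P i)), ← eta_mul, ← eta_mul, ← eta_mul (w := _ * _),
      rootReflection_mul_translate, mul_sub]
    simp only [eta_mul, mul_assoc]
  rw [e, map_sub, hinv, hinv]
  exact hdiff _ n

end Duals

end AffineDemazure

end

theorem theorem4 {R : Type u} [CommRing R] [IsDomain R] [CharZero R]
    {ι M N : Type v} [Finite ι] [AddCommGroup M] [AddCommGroup N]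
    (P : RootPairing ι ℤ M N) [P.IsReduced] (hP : Indecomposable P)
    (hsc : Submodule.span ℤ (Set.range P.coroot) = ⊤)
    (b : P.Base) (θ : ι) (hθ : IsHighestRoot b θ)
    {κ : Type v} [Finite κ] (B : Module.Basis κ ℤ M) (h : Theory R)
    (hcop : ∀ i j : ι, P.root i ≠ P.root j → P.root i ≠ -P.root j →
      (∃ μ : M, P.root i = (2 : ℤ) • μ) → (∃ μ : M, P.root j = (2 : ℤ) • μ) →
      ∀ s : (h.coefficients P B).carrier,
        (h.coefficients P B).x (P.root i) ∣ (h.coefficients P B).x (P.root j) * s →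
        (h.coefficients P B).x (P.root i) ∣ s) :
    let A : Coefficients P := h.coefficients P B
    (∀ φ : DemazureDual A b θ, ∃! f : TwistedDual A, Extends f φ) ∧
    demazureDual A b θ =
      {f : TwistedDual A |
        (∀ w : AffineWeylGroup P, MemMultiples 1 (f (eta A w))) ∧
        ∀ (i : ι) (w : AffineWeylGroup P) (d : ℕ), 1 ≤ d →
          MemMultiples (A.x (P.root i) ^ d)
            (f ((1 - eta A (translation P i)) ^ d * eta A w)) ∧
          MemMultiples (A.x (P.root i) ^ d)
            (f ((1 - eta A (translation P i)) ^ (d - 1) * (1 - eta A (rootReflection P i)) *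
              eta A w))} ∧
    demazureDual A b θ ∩ weylInvariants A =
      {f : TwistedDual A | f ∈ weylInvariants A ∧
        (∀ w : AffineWeylGroup P, MemMultiples 1 (f (eta A w))) ∧
        ∀ (i : ι) (w : AffineWeylGroup P) (d : ℕ), 1 ≤ d →
          MemMultiples (A.x (P.root i) ^ d)
            (f ((1 - eta A (translation P i)) ^ d * eta A w))} := by

  intro A
  have hA : A.IsFormalGroupAlgebra := h.isFormalGroupAlgebra B
  have hη := eta_mem_demazureAlgebra (A := A) hP hsc hθ
  have hdual : ∀ f : TwistedDual A, _ := fun f => mem_demazureDual_iff (f := f) hA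
    (fun i j hij hij' _ => hA.x_root_dvd_of_dvd_mul (hcop i j hij hij') hij hij') hη
    (demazureElement_mem hP hsc hθ hA) (translationElement_mem hP hsc hθ hA)
  refine ⟨existsUnique_extends hη, Set.ext hdual, Set.ext fun f => ⟨?_, ?_⟩⟩
  · rintro ⟨hf, hW⟩
    obtain ⟨h0, h1⟩ := (hdual f).1 hf
    exact ⟨hW, h0, fun i w d hd => (h1 i w d hd).1⟩
  · rintro ⟨hW, h0, h1⟩
    refine ⟨(hdual f).2 ⟨h0, fun i w d hd => ⟨h1 i w d hd, ?_⟩⟩, hW⟩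
    obtain ⟨d, rfl⟩ := Nat.exists_eq_add_of_le' hd
    exact memMultiples_of_mem_weylInvariants hW (fun w => h1 i w (d + 1) hd) w
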